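/- **Model.** Let $G$ be a connected undirected simple graph with $n$ anonymous nodes and $m$ edges; at each node $v$ the incident edges are numbered by ports $0,\dots,\deg v-1$ (the two ends of an edge are numbered independently). Robots with pairwise distinct identifiers from $[1,n^b]$, where $b>1$ is a constant, are placed on the nodes. Each robot knows $n$ and its own identifier, and nothing else about the graph or the other robots. Time is divided into synchronous rounds, and all robots start simultaneously. In a round, the robots at the same node exchange arbitrary messages and compute; then each robot stays or leaves through a port of its node. A robot sees the degree of its node and the port through which it entered. The initial configuration is *undispersed* if at least one node holds two or more robots. **Algorithm Undispersed-Gathering.** In the first round the robots determine their roles: a robot that is alone at its node is a *waiter*; otherwise it is a *finder* if its identifier is the smallest at its node, and a *helper* if not. Finders and helpers have a group identifier, initially the identifier of the finder at their node. Let $R_1=6n^3$. *Phase 1 (until $R_1$ rounds are over).* Waiters stay. Each finder builds a map of the graph, using the helpers of its group as a movable token, by the following exploration. The map initially consists of the starting node, its root, with all ports unexplored. As long as the map has unexplored ports, the finder takes the lexicographically first one, port $p$ of node $v$ (nodes are numbered in order of discovery). It walks with the token from the root along the discovery tree to $v$ and through port $p$ to a node $x$, recording the degree of $x$ and the port of entry;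 it leaves the token at $x$, walks back to the root, makes a depth-first tour of the discovery tree to check whether $x$ is one of the known nodes, walks to $x$ again, and brings the token back to the root. It then records the edge, and $x$ as a new node if $x$ was not known. When the map is complete, the group waits at the root. *Phase 2.* Each finder makes a depth-first closed walk along the spanning tree (the discovery tree) of its map, one edge per round, and then stays. In each round, let $g$ be the smallest group identifier among the finders and helpers at a node. A finder with group identifier $g$ continues its walk. Any other finder there becomes a helper and takes the group identifier $g$; it then follows the finder of group $g$ if that finder is present, and stays if not. A helper that meets a finder with a smaller group identifier than its own takes the smallest group identifier of the finders present and follows that finder. A waiter that meets a finder becomes a helper, takes the smallest group identifier of the finders present, and follows that finder. A follower makes the same moves as the finder that it follows, as long as that robot remains a finder. Each robot terminates when its round counter equals $R_1+2n$. **Theorem.** If the initial configuration is undispersed, then algorithm Undispersed-Gathering gathers all robots at a single node, with detection, in $O(n^3)$ rounds: after $O(n^3)$ rounds all robots have terminated, and whenever some robot has terminated, all robots are at that single node. Each robot uses $O(m\log n)$ bits of memory (where the constant may depend only on $b$); that is, under a fixed injective encoding of the memory states as bit strings, the memory of each robot after each round has length $O(m\log n)$. Moreover, at the end of Phase 1 each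 robot that was initially a finder has a map that is isomorphic to the port-labelled graph $G$, and the node of gathering is the initial node of the finder with the smallest identifier. -/

import Mathlib

namespace RobotGathering

/-! ### Port-labelled graphs -/

/-- A port labelling of a simple graph: at every node `v` the edges at `v` are numbered by
`0, …, deg v - 1`.  The two ends of an edge are numbered independently. -/
structure PortLabeling {V : Type*} [Fintype V] (G : SimpleGraph V) [DecidableRel G.Adj] where
  nbr : (v : V) → Fin (G.degree v) ≃ G.neighborSet v

section Ports

variable {V : Type*} [Fintype V] {G : SimpleGraph V} [DecidableRel G.Adj]

/-- The port, at the far end, of the edge that leaves `v` through port `p`. -/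
def PortLabeling.backPort (P : PortLabeling G) (v : V) (p : Fin (G.degree v)) : ℕ :=
  ((P.nbr (P.nbr v p : V)).symm ⟨v, (G.mem_neighborSet _ _).2
    ((G.mem_neighborSet _ _).1 (P.nbr v p).2).symm⟩ : ℕ)

/-- Leaving `v` through port `p`: the node reached and the port of entry there
(`none` if `v` has no port `p`). -/
def PortLabeling.traverse (P : PortLabeling G) (v : V) (p : ℕ) : Option (V × ℕ) :=
  if h : p < G.degree v then some ((P.nbr v ⟨p, h⟩ : V), P.backPort v ⟨p, h⟩) else none

end Ports

/-! ### Synchronous robots with face-to-face communication -/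

/-- What a robot tells the robots at its node in a round: its whole memory, and the port through
which it entered the node in the previous round (`none` if it did not move). -/
abbrev Message (S : Type) := S × Option ℕ

/-- A deterministic algorithm, the same for all robots.  `init n id` is the initial memory of the
robot with identifier `id`, which is given the number `n` of nodes.  In each round a robot that has
not terminated applies `act` to its own message, the degree of its node, and the multiset of the
messages of all robots at its node (itself included); this gives its new memory and the port through
which it leaves (`none` if it stays). -/
structure RobotAlgorithm where
  State : Type
  init : ℕ → ℕ → State
  terminated : State → Bool
  act : Message State → ℕ → Multiset (Message State) → State × Option ℕ

/-- Positions, entry ports and memories of the robots `ι`. -/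
structure Config (V ι : Type*) (S : Type) where
  pos : ι → V
  entry : ι → Option ℕ
  state : ι → S

section Execution

variable {V ι : Type*} [Fintype V] [DecidableEq V] [Fintype ι]
  {G : SimpleGraph V} [DecidableRel G.Adj]

/-- The messages available at the node `v`. -/
def Config.messages {S : Type} (c : Config V ι S) (v : V) : Multiset (Message S) :=
  (Finset.univ.filter fun j => c.pos j = v).val.map fun j => (c.state j, c.entry j)

/-- New memory and chosen port of robot `i` in the next round. -/
def RobotAlgorithm.decision (A : RobotAlgorithm) (G : SimpleGraph V) [DecidableRel G.Adj]
    (c : Config V ι A.State) (i : ι) : A.State × Option ℕ :=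
  if A.terminated (c.state i) then (c.state i, none)
  else A.act (c.state i, c.entry i) (G.degree (c.pos i)) (c.messages (c.pos i))

/-- One synchronous round. -/
def RobotAlgorithm.next (A : RobotAlgorithm) (P : PortLabeling G) (c : Config V ι A.State) :
    Config V ι A.State where
  pos i := (((A.decision G c i).2.bind (P.traverse (c.pos i))).map Prod.fst).getD (c.pos i)
  entry i := ((A.decision G c i).2.bind (P.traverse (c.pos i))).map Prod.snd
  state i := (A.decision G c i).1

/-- The configuration after `t` rounds: the robots `i : ι`, with identifiers `ident i`, are started
simultaneously at the nodes `start i`. -/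
def RobotAlgorithm.run (A : RobotAlgorithm) (P : PortLabeling G) (ident : ι → ℕ) (start : ι → V) :
    ℕ → Config V ι A.State
  | 0 => { pos := start, entry := fun _ => none,
           state := fun i => A.init (Fintype.card V) (ident i) }
  | t + 1 => A.next P (A.run P ident start t)

end Execution

/-- Robot `i` is not alone at its node in the initial configuration `start`. -/
def Accompanied {V ι : Type*} (start : ι → V) (i : ι) : Prop :=
  ∃ j, j ≠ i ∧ start j = start i

/-- The initial configuration is undispersed: some node holds at least two robots. -/
def Undispersed {V ι : Type*} (start : ι → V) : Prop :=
  ∃ i, Accompanied start i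

/-- `i` is initially a finder: it is not alone, and it has the smallest identifier at its node. -/
def IsFinder {V ι : Type*} (ident : ι → ℕ) (start : ι → V) (i : ι) : Prop :=
  Accompanied start i ∧ ∀ j, start j = start i → ident i ≤ ident j

/-- Gathering with detection at the node `v` within `T` rounds: after `T` rounds all robots have
terminated, and whenever some robot has terminated, all robots are at `v`. -/
def RobotAlgorithm.GathersWithDetection {V ι : Type*} [Fintype V] [DecidableEq V] [Fintype ι]
    {G : SimpleGraph V} [DecidableRel G.Adj] (A : RobotAlgorithm) (P : PortLabeling G)
    (ident : ι → ℕ) (start : ι → V) (v : V) (T : ℕ) : Prop :=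
  (∀ i, A.terminated ((A.run P ident start T).state i) = true) ∧
  ∀ t i, A.terminated ((A.run P ident start t).state i) = true →
    ∀ j, (A.run P ident start t).pos j = v

/-! ### Maps with a spanning tree -/

/-- What a map stores about a node.  `adj` has one entry per port: `some (w, q)` if the edge at this
port is known to lead to node `w` and to enter it through port `q`, and `none` if the edge has not
been explored.  Except at the root `0`, the tree edge to the node `parent` has port `down` at
`parent` and port `up` at this node. -/
structure NodeRecord where
  parent : ℕ
  down : ℕ
  up : ℕ
  adj : List (Option (ℕ × ℕ))

/-- A (partial) map: the records of the nodes `0, 1, 2, …`, in the order of their discovery. -/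
abbrev GraphMap := List NodeRecord

namespace GraphMap

def node (M : GraphMap) (v : ℕ) : NodeRecord := M.getD v ⟨0, 0, 0, []⟩

/-- The unexplored ports `(v, p)`, in lexicographic order. -/
def openPorts (M : GraphMap) : List (ℕ × ℕ) :=
  (List.range M.length).flatMap fun v =>
    ((List.range (M.node v).adj.length).filter fun p => (M.node v).adj[p]? = some none).map
      fun p => (v, p)

/-- Ports of the tree path from the root to `v` (the first argument bounds its length). -/
def descend (M : GraphMap) : ℕ → ℕ → List ℕ
  | 0, _ => []
  | f + 1, v =>
    if v = 0 then [] else descend M f (M.node v).parent ++ [(M.node v).down]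

/-- Ports of the tree path from `v` to the root (the first argument bounds its length). -/
def ascend (M : GraphMap) : ℕ → ℕ → List ℕ
  | 0, _ => []
  | f + 1, v =>
    if v = 0 then [] else (M.node v).up :: ascend M f (M.node v).parent

def children (M : GraphMap) (u : ℕ) : List ℕ :=
  (List.range M.length).filter fun w => w ≠ 0 ∧ (M.node w).parent = u

/-- The depth-first closed walk from `u` through the part of the tree below `u`: the list of the
ports taken, each with the node that it leads to (the first argument bounds the depth). -/
def tourFrom (M : GraphMap) : ℕ → ℕ → List (ℕ × ℕ)
  | 0, _ => []
  | f + 1, u => (M.children u).flatMap fun w =>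
      ((M.node w).down, w) :: tourFrom M f w ++ [((M.node w).up, u)]

/-- The depth-first closed walk along the spanning tree from the root. -/
def tour (M : GraphMap) : List (ℕ × ℕ) := tourFrom M M.length 0

/-- Record that port `p` of `v` leads to `w` and enters it through port `q`. -/
def setPort (M : GraphMap) (v p w q : ℕ) : GraphMap :=
  M.modify v fun r => { r with adj := r.adj.set p (some (w, q)) }

/-- The map after exploring port `p` of `v`: the node behind it, entered through port `q`, has
degree `d`; it is the known node `w` if `hit = some w`, and a new node if `hit = none`. -/
def extend (M : GraphMap) (v p q d : ℕ) (hit : Option ℕ) : GraphMap :=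
  match hit with
  | some w => (M.setPort v p w q).setPort w q v p
  | none => M.setPort v p M.length q ++
      [⟨v, p, q, (List.replicate d none).set q (some (v, p))⟩]

/-- `M` is a complete map of the port-labelled graph with root `r`: it is isomorphic to it. -/
def IsMapOf {V : Type*} [Fintype V] {G : SimpleGraph V} [DecidableRel G.Adj]
    (M : GraphMap) (P : PortLabeling G) (r : V) : Prop :=
  ∃ e : V ≃ Fin M.length, (e r : ℕ) = 0 ∧
    ∀ v, (M.get (e v)).adj =
      List.ofFn fun p : Fin (G.degree v) => some ((e (P.nbr v p : V) : ℕ), P.backPort v p)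

end GraphMap

/-! ### Exploration with a movable token -/

/-- A move of the explorer: the port, whether the token is taken along, and (for the moves of the
tour in search of the token) the known node that the move leads to. -/
structure Move where
  port : ℕ
  carry : Bool
  goal : Option ℕ

/-- The walk by which port `p` of the known node `v` is explored, starting and ending at the root:
take the token to `v` and through port `p`, to a node entered through port `q`; leave it there,
go back to the root and tour all known nodes in search of the token; go to the token again,
and take it back to the root. -/
def explorationWalk (M : GraphMap) (v p q : ℕ) : List Move :=
  (M.descend M.length v).map (fun x => ⟨x, true, none⟩) ++ [⟨p, true, none⟩] ++
  ([⟨q, false, none⟩] ++ (M.ascend M.length v).map (fun x => ⟨x, false, none⟩)) ++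
  M.tour.map (fun x => ⟨x.1, false, some x.2⟩) ++
  ((M.descend M.length v).map (fun x => ⟨x, false, none⟩) ++ [⟨p, false, none⟩]) ++
  ([⟨q, true, none⟩] ++ (M.ascend M.length v).map (fun x => ⟨x, true, none⟩))

/-- The memory of the explorer: the map, the number `pc` of moves already made in the current
exploration walk, the port `q` and the degree `d` found at the unknown node, and the known node
where the token was seen during the tour. -/
structure Survey where
  map : GraphMap
  pc : ℕ
  q : ℕ
  d : ℕ
  hit : Option ℕ

namespace Survey

/-- The map of a single node of degree `d` with all ports unexplored. -/
def start (d : ℕ) : Survey := ⟨[⟨0, 0, 0, List.replicate d none⟩], 0, 0, 0, none⟩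

/-- The current exploration walk: it explores the first unexplored port of the map. -/
def walk (s : Survey) : List Move :=
  match s.map.openPorts.head? with
  | none => []
  | some (v, p) => explorationWalk s.map v p s.q

/-- Evaluate the arrival at the present node, which has degree `deg`, was entered through port
`entry`, and holds the token if `token` is true. -/
def arrive (s : Survey) (deg : ℕ) (entry : Option ℕ) (token : Bool) : Survey :=
  match s.map.openPorts.head? with
  | none => s
  | some (v, _) =>
    if s.pc = (s.map.descend s.map.length v).length + 1 then
      { s with q := entry.getD 0, d := deg }
    else if s.pc = 0 then s
    else match (s.walk[s.pc - 1]?).bind Move.goal with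
      | some w => if token then { s with hit := some w } else s
      | none => s

/-- If the exploration walk is finished, then extend the map. -/
def conclude (s : Survey) : Survey :=
  match s.map.openPorts.head? with
  | none => s
  | some (v, p) =>
    if s.pc = s.walk.length then ⟨s.map.extend v p s.q s.d s.hit, 0, 0, 0, none⟩ else s

/-- The memory on which the next move is based. -/
def update (s : Survey) (deg : ℕ) (entry : Option ℕ) (token : Bool) : Survey :=
  (s.arrive deg entry token).conclude

/-- The next move; there is none once the map is complete. -/
def nextMove (s : Survey) : Option Move := s.walk[s.pc]?

/-- Count the next move as made. -/
def advance (s : Survey) : Survey :=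
  match s.nextMove with
  | none => s
  | some _ => { s with pc := s.pc + 1 }

end Survey

/-! ### The algorithm Undispersed-Gathering -/

inductive Role where
  | undecided | finder | helper | waiter
  deriving DecidableEq

/-- The memory of a robot: the number `n` of nodes, its identifier, the number of rounds since the
start, its role, its group identifier (`0`, which is no identifier, for robots without a group),
whether it is following the finder with identifier `gid`, and the survey of a finder. -/
structure RobotState where
  n : ℕ
  ident : ℕ
  clock : ℕ
  role : Role
  gid : ℕ
  follows : Bool
  survey : Survey

/-- The number of rounds of the first phase. -/
def phaseOneLength (n : ℕ) : ℕ := 6 * n ^ 3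

/-- The least element of a finite multiset of numbers (`none` if it is empty). -/
def least (s : Multiset ℕ) : Option ℕ := (s.sort (· ≤ ·)).head?

/-- The robots at a node, as they present themselves. -/
abbrev Peers := Multiset (Message RobotState)

/-- The beginning: the robots determine their roles and stay. -/
def assignRole (me : RobotState) (deg : ℕ) (peers : Peers) : RobotState :=
  if peers.card ≤ 1 then { me with role := .waiter, gid := 0 }
  else
    let g := (least (peers.map fun x => x.1.ident)).getD me.ident
    if me.ident = g then { me with role := .finder, gid := g, survey := Survey.start deg }
    else { me with role := .helper, gid := g }

/-- Some helper of the group of the robot `x` is present. -/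
def tokenPresent (x : RobotState) (peers : Peers) : Bool :=
  decide (0 < (peers.filter fun y => y.1.role = .helper ∧ y.1.gid = x.ident).card)

/-- The survey of the finder that sends the message `x`, updated by its present observations. -/
def currentSurvey (x : Message RobotState) (deg : ℕ) (peers : Peers) : Survey :=
  x.1.survey.update deg x.2 (tokenPresent x.1 peers)

/-- The port, if any, through which the present finder of group `g` takes its token along. -/
def carryPort (g : ℕ) (deg : ℕ) (peers : Peers) : Option ℕ :=
  least (peers.filterMap fun x =>
    if x.1.role = .finder ∧ x.1.ident = g then
      (currentSurvey x deg peers).nextMove.bind fun m => if m.carry then some m.port else none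
    else none)

/-- First phase: each finder explores with its helpers as the token; waiters stay. -/
def phaseOne (me : Message RobotState) (deg : ℕ) (peers : Peers) : RobotState × Option ℕ :=
  match me.1.role with
  | .finder =>
    let s := currentSurvey me deg peers
    ({ me.1 with survey := s.advance }, s.nextMove.map Move.port)
  | .helper => (me.1, carryPort me.1.gid deg peers)
  | _ => (me.1, none)

/-- The least group identifier of the finders and helpers present. -/
def leastGroup (peers : Peers) : Option ℕ :=
  least (peers.filterMap fun x =>
    if x.1.role = .finder ∨ x.1.role = .helper then some x.1.gid else none)

/-- The least group identifier of the finders present. -/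
def leastFinder (peers : Peers) : Option ℕ :=
  least (peers.filterMap fun x => if x.1.role = .finder then some x.1.gid else none)

/-- The next port of a finder on its tour along the spanning tree of its map (`none` at the end). -/
def tourPort (x : RobotState) : Option ℕ :=
  (x.survey.map.tour[x.clock - phaseOneLength x.n]?).map Prod.fst

/-- The port through which the present finder of group `g` leaves; it only continues its tour if `g`
is the least group identifier present. -/
def leaderPort (g : ℕ) (peers : Peers) : Option ℕ :=
  if leastGroup peers = some g then
    least (peers.filterMap fun x =>
      if x.1.role = .finder ∧ x.1.gid = g then tourPort x.1 else none)
  else none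

/-- Second phase: gathering along the spanning trees. -/
def phaseTwo (me : RobotState) (peers : Peers) : RobotState × Option ℕ :=
  match me.role with
  | .finder =>
    let g := (leastGroup peers).getD me.gid
    if g = me.gid then (me, tourPort me)
    else if leastFinder peers = some g then
      ({ me with role := .helper, gid := g, follows := true }, leaderPort g peers)
    else ({ me with role := .helper, gid := g, follows := false }, none)
  | .helper =>
    let me' : RobotState :=
      match leastFinder peers with
      | some g => if g < me.gid then { me with gid := g, follows := true } else me
      | none => me
    (me', if me'.follows then leaderPort me'.gid peers else none)
  | .waiter =>
    match leastFinder peers with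
    | some g => ({ me with role := .helper, gid := g, follows := true }, leaderPort g peers)
    | none => (me, none)
  | .undecided => (me, none)

/-- One round of a robot: roles in the first round, then the first phase until
`phaseOneLength n` rounds are over, then the second phase. -/
def robotAct (me : Message RobotState) (deg : ℕ) (peers : Peers) : RobotState × Option ℕ :=
  let r : RobotState × Option ℕ :=
    if me.1.clock = 0 then (assignRole me.1 deg peers, none)
    else if me.1.clock < phaseOneLength me.1.n then phaseOne me deg peers
    else phaseTwo me.1 peers
  ({ r.1 with clock := me.1.clock + 1 }, r.2)

/-- The algorithm Undispersed-Gathering.  A robot terminates when its round counter equals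
`phaseOneLength n + 2 * n`. -/
def undispersedGathering : RobotAlgorithm where
  State := RobotState
  init n ident := ⟨n, ident, 0, .undecided, 0, false, ⟨[], 0, 0, 0, none⟩⟩
  terminated s := decide (s.clock = phaseOneLength s.n + 2 * s.n)
  act := robotAct

end RobotGathering

/-!
# Undispersed-Gathering gathers all robots with detection

*First phase.*  Helpers change their group only in the second phase, and a finder looks for helpers
of its own group only.  Hence a finder with its helpers behaves as if no other robots were present
(`PhaseOneInv.soloView_next`), and it suffices to study one explorer with one token (`soloStep`).
The invariant is that the map is a correct partial map of the graph (`PartialMap`): it comes with an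
injection of its nodes into the graph that respects degrees, explored ports and tree edges.  The
tour of the tree visits every known node, so the token is seen exactly if the unknown node is a
known one (`PartialMap.foldl_explorationWalk`), and the extension of the map is correct again
(`PartialMap.extend`).  One exploration takes at most `6 n - 2` rounds and explores at least one new
port, of which there are at most `n (n - 1)`; so the map is complete in time (`Progress.complete`).
A correct map without open ports is closed under adjacency, and therefore isomorphic to a connected
graph (`PartialMap.isMapOf`).

*Second phase.*  Let `f` be the finder of least identifier; nobody stops it.  The initial helpers of
`f` never follow anybody, so they stay at the root of `f` throughout.  A finder other than `f`
visits the root of `f` on its tour, unless it becomes a helper before, and is absorbed there at the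
latest.  A robot that is neither with `f`, nor at the root of `f`, nor a finder or follower of a
finder, is at a node that `f` has not visited yet: when `f` comes to a node it takes all robots
there along (those at its root excepted, which are already in place); and a finder and its
followers either join a smaller finder that moves on, or they are left standing at the node of a
helper that stands still, and this node is the root of `f` or not yet visited by `f`.  This is the invariant `PhaseTwoInv`.  The tours have
at most `2 n - 2` moves and visit all nodes, so after `2 n` rounds all robots are at the root of `f`
(`PhaseTwoInv.pos_eq`).

*Memory.*  States are encoded by self-delimiting codes (`PrefixFree`).  A state consists of
`O(n + m) = O(m)` numbers, since the adjacency lists of a partial map have total length at most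
`2 m`, and each number is bounded by a power of `n` with exponent depending on `b` only.
-/

namespace RobotGathering

/-! ### Ports -/

section Ports

variable {V : Type*} [Fintype V] {G : SimpleGraph V} [DecidableRel G.Adj]

/-- The port at `v` of the edge from `v` to its neighbour `w`. -/
def PortLabeling.portTo (P : PortLabeling G) {v w : V} (h : G.Adj v w) : ℕ :=
  (P.nbr v).symm ⟨w, (G.mem_neighborSet _ _).2 h⟩

theorem PortLabeling.portTo_lt (P : PortLabeling G) {v w : V} (h : G.Adj v w) :
    P.portTo h < G.degree v := Fin.isLt _

theorem PortLabeling.nbr_adj (P : PortLabeling G) (v : V) (p : Fin (G.degree v)) :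
    G.Adj v (P.nbr v p) := (G.mem_neighborSet _ _).1 (P.nbr v p).2

theorem PortLabeling.portTo_nbr (P : PortLabeling G) (v : V) (p : Fin (G.degree v)) :
    P.portTo (P.nbr_adj v p) = p := by
  simp [PortLabeling.portTo]

theorem PortLabeling.traverse_of_lt (P : PortLabeling G) {v : V} {p : ℕ} (h : p < G.degree v) :
    P.traverse v p = some ((P.nbr v ⟨p, h⟩ : V), P.backPort v ⟨p, h⟩) := by
  simp [PortLabeling.traverse, h]

theorem PortLabeling.traverse_portTo (P : PortLabeling G) {v w : V} (h : G.Adj v w) :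
    P.traverse v (P.portTo h) = some (w, P.portTo h.symm) := by
  rw [P.traverse_of_lt (P.portTo_lt h)]
  have key : ∀ x : G.neighborSet v, x = ⟨w, (G.mem_neighborSet _ _).2 h⟩ →
      ∀ h' : v ∈ G.neighborSet (x : V),
      ((x : V), (((P.nbr (x : V)).symm ⟨v, h'⟩ : Fin _) : ℕ)) = (w, P.portTo h.symm) := by
    rintro x rfl h'
    rfl
  exact congrArg some (key _ (by simp [PortLabeling.portTo]) _)

theorem PortLabeling.traverse_eq_some_iff (P : PortLabeling G) {v w : V} {p q : ℕ} :
    P.traverse v p = some (w, q) ↔ ∃ h : G.Adj v w, p = P.portTo h ∧ q = P.portTo h.symm := by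
  constructor
  · intro h
    by_cases hp : p < G.degree v
    · have h2 := P.traverse_portTo (P.nbr_adj v ⟨p, hp⟩)
      rw [P.portTo_nbr] at h2
      have h3 := h.symm.trans h2
      simp only [Option.some.injEq, Prod.mk.injEq] at h3
      obtain ⟨rfl, rfl⟩ := h3
      exact ⟨P.nbr_adj v ⟨p, hp⟩, (P.portTo_nbr v ⟨p, hp⟩).symm, rfl⟩
    · simp [PortLabeling.traverse, hp] at h
  · rintro ⟨hvw, rfl, rfl⟩
    exact P.traverse_portTo hvw

/-- Returning through the port of entry undoes a move. -/
theorem PortLabeling.traverse_symm (P : PortLabeling G) {v w : V} {p q : ℕ}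
    (h : P.traverse v p = some (w, q)) : P.traverse w q = some (v, p) := by
  obtain ⟨hvw, rfl, rfl⟩ := P.traverse_eq_some_iff.1 h
  exact P.traverse_portTo hvw.symm

theorem PortLabeling.lt_degree_of_traverse (P : PortLabeling G) {v w : V} {p q : ℕ}
    (h : P.traverse v p = some (w, q)) : p < G.degree v := by
  obtain ⟨hvw, rfl, rfl⟩ := P.traverse_eq_some_iff.1 h
  exact P.portTo_lt hvw

theorem PortLabeling.ne_of_traverse (P : PortLabeling G) {v w : V} {p q : ℕ}
    (h : P.traverse v p = some (w, q)) : v ≠ w := by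
  obtain ⟨h, -, -⟩ := P.traverse_eq_some_iff.1 h
  exact h.ne

end Ports

/-! ### Partial maps -/

namespace GraphMap

theorem node_of_getElem? {M : GraphMap} {v : ℕ} {r : NodeRecord} (h : M[v]? = some r) :
    M.node v = r := by
  simp [node, List.getD, h]

theorem mem_openPorts {M : GraphMap} {v p : ℕ} :
    (v, p) ∈ M.openPorts ↔ v < M.length ∧ (M.node v).adj[p]? = some none := by
  simp only [openPorts, List.mem_flatMap, List.mem_range, List.mem_map, List.mem_filter,
    Prod.mk.injEq, decide_eq_true_eq]
  constructor
  · rintro ⟨a, ha, b, ⟨_, hb⟩, rfl, rfl⟩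
    exact ⟨ha, hb⟩
  · rintro ⟨ha, hb⟩
    exact ⟨v, ha, p, ⟨(List.getElem?_eq_some_iff.1 hb).1, hb⟩, rfl, rfl⟩

@[simp] theorem length_setPort (M : GraphMap) (v p w q : ℕ) :
    (M.setPort v p w q).length = M.length := by
  simp [setPort]

theorem node_setPort (M : GraphMap) (v p w q u : ℕ) :
    (M.setPort v p w q).node u =
      if u = v then { M.node u with adj := (M.node u).adj.set p (some (w, q)) } else M.node u := by
  by_cases h : u = v
  · subst h
    rcases hu : M[u]? with _ | r <;> simp [setPort, node, List.getD, hu]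
  · simp [setPort, node, List.getD, h, Ne.symm h]

theorem node_append_of_lt {M : GraphMap} {r : NodeRecord} {u : ℕ} (h : u < M.length) :
    GraphMap.node (M ++ [r]) u = M.node u := by
  simp [node, List.getD, List.getElem?_append_left h]

theorem node_append_length {M : GraphMap} {r : NodeRecord} :
    GraphMap.node (M ++ [r]) M.length = r := by
  simp [node, List.getD]

theorem setPort_append {M : GraphMap} {r : NodeRecord} {v p w q : ℕ} (h : v < M.length) :
    M.setPort v p w q ++ [r] = setPort (M ++ [r]) v p w q := by
  apply List.ext_getElem?
  intro i
  unfold setPort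
  rw [List.getElem?_modify, List.getElem?_append, List.getElem?_append, List.length_modify,
    List.getElem?_modify]
  by_cases hi : i < M.length
  · simp [hi]
  · have : v ≠ i := by omega
    simp [hi, this]

/-- The number of explored ports. -/
def explored (M : GraphMap) : ℕ :=
  ∑ v ∈ Finset.range M.length, (M.node v).adj.countP Option.isSome

theorem countP_isSome_le_set {α : Type*} (l : List (Option α)) (p : ℕ) (a : α) :
    l.countP Option.isSome ≤ (l.set p (some a)).countP Option.isSome := by
  by_cases h : p < l.length
  · rw [List.countP_set h]
    simp
    split <;> omega
  · rw [List.set_eq_of_length_le (by omega)]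

theorem countP_isSome_lt_set {α : Type*} {l : List (Option α)} {p : ℕ} (a : α)
    (h : l[p]? = some none) :
    l.countP Option.isSome < (l.set p (some a)).countP Option.isSome := by
  obtain ⟨hp, h⟩ := List.getElem?_eq_some_iff.1 h
  rw [List.countP_set hp, h]
  simp

theorem explored_le_setPort (M : GraphMap) (v p w q : ℕ) :
    M.explored ≤ (M.setPort v p w q).explored := by
  unfold explored
  rw [length_setPort]
  refine Finset.sum_le_sum fun u _ => ?_
  rw [node_setPort]
  split
  · exact countP_isSome_le_set _ _ _
  · exact le_rfl

theorem explored_lt_setPort {M : GraphMap} {v p : ℕ} (w q : ℕ) (h : (v, p) ∈ M.openPorts) :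
    M.explored < (M.setPort v p w q).explored := by
  obtain ⟨hv, hp⟩ := mem_openPorts.1 h
  unfold explored
  rw [length_setPort]
  refine Finset.sum_lt_sum (fun u _ => ?_) ⟨v, Finset.mem_range.2 hv, ?_⟩
  · rw [node_setPort]
    split
    · exact countP_isSome_le_set _ _ _
    · exact le_rfl
  · rw [node_setPort, if_pos rfl]
    exact countP_isSome_lt_set _ hp

theorem explored_lt_extend {M : GraphMap} {v p : ℕ} (q d : ℕ) (hit : Option ℕ)
    (h : (v, p) ∈ M.openPorts) : M.explored < (M.extend v p q d hit).explored := by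
  rcases hit with _ | w
  · refine lt_of_lt_of_le (explored_lt_setPort M.length q h) ?_
    simp only [extend, explored, List.length_append, List.length_singleton, Finset.sum_range_succ]
    refine le_add_right (Finset.sum_le_sum fun u hu => ?_)
    rw [node_append_of_lt (Finset.mem_range.1 hu)]
  · exact lt_of_lt_of_le (explored_lt_setPort w q h) (explored_le_setPort _ _ _ _ _)

end GraphMap

section PartialMap

variable {V : Type*} [Fintype V] {G : SimpleGraph V} [DecidableRel G.Adj]

/-- `M` is a correct partial map of the port-labelled graph, with root `r`: node `v` of `M` stands
for the node `φ v` of the graph.  The values of `φ` outside the range of node numbers of `M` are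
irrelevant. -/
structure PartialMap (P : PortLabeling G) (r : V) (M : GraphMap) (φ : ℕ → V) : Prop where
  length_pos : 0 < M.length
  root : φ 0 = r
  root_record : (M.node 0).parent = 0 ∧ (M.node 0).down = 0 ∧ (M.node 0).up = 0
  inj : ∀ u < M.length, ∀ v < M.length, φ u = φ v → u = v
  degree : ∀ v < M.length, (M.node v).adj.length = G.degree (φ v)
  adj : ∀ v < M.length, ∀ p w q, (M.node v).adj[p]? = some (some (w, q)) →
    w < M.length ∧ P.traverse (φ v) p = some (φ w, q)
  tree : ∀ w < M.length, w ≠ 0 → (M.node w).parent < w ∧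
    P.traverse (φ (M.node w).parent) (M.node w).down = some (φ w, (M.node w).up)

namespace PartialMap

variable {P : PortLabeling G} {r : V} {M : GraphMap} {φ : ℕ → V}

theorem singleton (P : PortLabeling G) (r : V) :
    PartialMap P r [⟨0, 0, 0, List.replicate (G.degree r) none⟩] (fun _ => r) where
  length_pos := by simp
  root := rfl
  root_record := ⟨rfl, rfl, rfl⟩
  inj u hu v hv _ := by simp at hu hv; omega
  degree v hv := by
    simp at hv; subst hv; simp [GraphMap.node]
  adj v hv p w q h := by
    simp at hv; subst hv
    simp [GraphMap.node, List.getElem?_replicate] at h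
  tree w hw h0 := by simp at hw; omega

theorem setPort (h : PartialMap P r M φ) {v p w q : ℕ} (hv : v < M.length) (hw : w < M.length)
    (ht : P.traverse (φ v) p = some (φ w, q)) : PartialMap P r (M.setPort v p w q) φ where
  length_pos := by simpa using h.length_pos
  root := h.root
  root_record := by
    rw [GraphMap.node_setPort]
    split <;> exact h.root_record
  inj := by simpa using h.inj
  degree u hu := by
    rw [GraphMap.length_setPort] at hu
    rw [GraphMap.node_setPort, ← h.degree u hu]
    split <;> simp
  adj u hu p' w' q' := by
    rw [GraphMap.length_setPort] at hu ⊢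
    rw [GraphMap.node_setPort]
    split
    · next huv =>
      subst huv
      simp only [List.getElem?_set]
      split
      · next hp =>
        subst hp
        split
        · intro hs
          simp only [Option.some.injEq, Prod.mk.injEq] at hs
          obtain ⟨rfl, rfl⟩ := hs
          exact ⟨hw, ht⟩
        · intro hs; cases hs
      · exact h.adj u hu p' w' q'
    · exact h.adj u hu p' w' q'
  tree u hu h0 := by
    rw [GraphMap.length_setPort] at hu
    have := h.tree u hu h0
    rw [GraphMap.node_setPort]
    split <;> exact this

theorem append (h : PartialMap P r M φ) {v p q : ℕ} {x : V} (hv : v < M.length)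
    (ht : P.traverse (φ v) p = some (x, q)) (hx : ∀ w < M.length, φ w ≠ x) :
    PartialMap P r (M ++ [⟨v, p, q, (List.replicate (G.degree x) none).set q (some (v, p))⟩])
      (Function.update φ M.length x) := by
  have hu : ∀ u < M.length, Function.update φ M.length x u = φ u := fun u hu =>
    Function.update_of_ne hu.ne _ _
  have hl : Function.update φ M.length x M.length = x := Function.update_self _ _ _
  have hcases : ∀ {u}, u < (M ++ [(⟨v, p, q, (List.replicate (G.degree x) none).set q
      (some (v, p))⟩ : NodeRecord)]).length → u < M.length ∨ u = M.length := by
    intro u hu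
    simp at hu
    omega
  refine ⟨by simp, by rw [hu 0 h.length_pos, h.root], ?_, ?_, ?_, ?_, ?_⟩
  · rw [GraphMap.node_append_of_lt h.length_pos]
    exact h.root_record
  · intro a ha b hb hab
    rcases hcases ha with ha | rfl <;> rcases hcases hb with hb | rfl
    · rw [hu a ha, hu b hb] at hab
      exact h.inj a ha b hb hab
    · rw [hu a ha, hl] at hab
      exact absurd hab (hx a ha)
    · rw [hu b hb, hl] at hab
      exact absurd hab.symm (hx b hb)
    · rfl
  · intro a ha
    rcases hcases ha with ha | rfl
    · rw [hu a ha, GraphMap.node_append_of_lt ha, h.degree a ha]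
    · rw [hl, GraphMap.node_append_length]
      simp
  · intro a ha p' w' q'
    rcases hcases ha with ha | rfl
    · rw [hu a ha, GraphMap.node_append_of_lt ha]
      intro hs
      obtain ⟨h1, h2⟩ := h.adj a ha p' w' q' hs
      exact ⟨by simp; omega, by rw [h2, hu w' h1]⟩
    · rw [hl, GraphMap.node_append_length]
      simp only [List.getElem?_set, List.getElem?_replicate]
      split
      · next hp =>
        subst hp
        split
        · intro hs
          simp only [Option.some.injEq, Prod.mk.injEq] at hs
          obtain ⟨rfl, rfl⟩ := hs
          exact ⟨by simp; omega, by rw [hu _ hv]; exact P.traverse_symm ht⟩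
        · intro hs; cases hs
      · split <;> intro hs <;> simp at hs
  · intro w hw h0
    rcases hcases hw with hw | rfl
    · have := h.tree w hw h0
      rw [GraphMap.node_append_of_lt hw, hu w hw, hu _ (this.1.trans hw)]
      exact this
    · rw [GraphMap.node_append_length, hl]
      exact ⟨hv, by rw [hu v hv]; exact ht⟩

/-- Recording the explored port keeps the map correct, if the node behind it was recognized
correctly. -/
theorem extend (h : PartialMap P r M φ) {v p q : ℕ} {x : V} {hit : Option ℕ} (hv : v < M.length)
    (ht : P.traverse (φ v) p = some (x, q)) (hs : ∀ w, hit = some w → w < M.length ∧ φ w = x)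
    (hn : hit = none → ∀ w < M.length, φ w ≠ x) :
    ∃ φ', PartialMap P r (M.extend v p q (G.degree x) hit) φ' := by
  rcases hit with _ | w
  · refine ⟨Function.update φ M.length x, ?_⟩
    simp only [GraphMap.extend]
    rw [GraphMap.setPort_append hv]
    refine (h.append hv ht (hn rfl)).setPort (by simp; omega) (by simp) ?_
    rw [Function.update_of_ne hv.ne, Function.update_self, ht]
  · obtain ⟨hw, rfl⟩ := hs w rfl
    exact ⟨φ, (h.setPort hv hw ht).setPort (by simpa using hw) (by simpa using hv)
      (P.traverse_symm ht)⟩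

theorem length_le (h : PartialMap P r M φ) : M.length ≤ Fintype.card V := by
  have hi : Function.Injective fun i : Fin M.length => φ i := fun a b hab =>
    Fin.ext (h.inj a a.2 b b.2 hab)
  simpa using Fintype.card_le_of_injective _ hi

theorem sum_degree_le (h : PartialMap P r M φ) :
    ∑ v ∈ Finset.range M.length, (M.node v).adj.length ≤ 2 * G.edgeFinset.card := by
  classical
  rw [← G.sum_degrees_eq_twice_card_edges]
  calc ∑ v ∈ Finset.range M.length, (M.node v).adj.length
      = ∑ v ∈ Finset.range M.length, G.degree (φ v) :=
        Finset.sum_congr rfl fun v hv => h.degree v (Finset.mem_range.1 hv)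
    _ = ∑ x ∈ (Finset.range M.length).image φ, G.degree x := by
        rw [Finset.sum_image]
        intro a ha b hb hab
        exact h.inj a (by simpa using ha) b (by simpa using hb) hab
    _ ≤ ∑ x, G.degree x := Finset.sum_le_sum_of_subset (Finset.subset_univ _)

theorem explored_le (h : PartialMap P r M φ) :
    M.explored ≤ Fintype.card V * (Fintype.card V - 1) := by
  calc M.explored ≤ ∑ v ∈ Finset.range M.length, (Fintype.card V - 1) := by
        refine Finset.sum_le_sum fun v hv => ?_
        refine (List.countP_le_length).trans ?_
        rw [h.degree v (Finset.mem_range.1 hv)]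
        have := G.degree_lt_card_verts (φ v)
        omega
    _ = M.length * (Fintype.card V - 1) := by simp
    _ ≤ _ := Nat.mul_le_mul_right _ h.length_le

/-- In a map without open ports, the known nodes are closed under adjacency; so a connected graph
is known entirely. -/
theorem surjective_of_openPorts_eq_nil (h : PartialMap P r M φ) (ho : M.openPorts = [])
    (hG : G.Connected) (x : V) : ∃ v < M.length, φ v = x := by
  obtain ⟨w⟩ := hG.preconnected r x
  suffices H : ∀ {a b : V}, G.Walk a b → (∃ v < M.length, φ v = a) → ∃ v < M.length, φ v = b from
    H w ⟨0, h.length_pos, h.root⟩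
  intro a b w
  induction w with
  | nil => exact id
  | cons hab _ ih =>
    rintro ⟨v, hv, rfl⟩
    apply ih
    have hlt : P.portTo hab < (M.node v).adj.length := by
      rw [h.degree v hv]; exact P.portTo_lt hab
    rcases hc : (M.node v).adj[P.portTo hab] with _ | ⟨w, q⟩
    · have : (v, P.portTo hab) ∈ M.openPorts :=
        GraphMap.mem_openPorts.2 ⟨hv, List.getElem?_eq_some_iff.2 ⟨hlt, hc⟩⟩
      rw [ho] at this
      cases this
    · obtain ⟨h1, h2⟩ := h.adj v hv _ w q (List.getElem?_eq_some_iff.2 ⟨hlt, hc⟩)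
      rw [P.traverse_portTo hab] at h2
      simp only [Option.some.injEq, Prod.mk.injEq] at h2
      exact ⟨w, h1, h2.1.symm⟩

theorem isMapOf (h : PartialMap P r M φ) (ho : M.openPorts = []) (hG : G.Connected) :
    M.IsMapOf P r := by
  have hb : Function.Bijective fun i : Fin M.length => φ i := by
    refine ⟨fun a b hab => Fin.ext (h.inj a a.2 b b.2 hab), fun x => ?_⟩
    obtain ⟨v, hv, hx⟩ := h.surjective_of_openPorts_eq_nil ho hG x
    exact ⟨⟨v, hv⟩, hx⟩
  let e := (Equiv.ofBijective _ hb).symm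
  have he : ∀ v, φ (e v) = v := fun v => (Equiv.ofBijective _ hb).apply_symm_apply v
  have he' : ∀ u (hu : u < M.length) v, φ u = v → (e v : ℕ) = u := by
    rintro u hu v rfl
    exact h.inj _ (e _).2 u hu (he _)
  refine ⟨e, he' 0 h.length_pos r h.root, fun v => ?_⟩
  have hnode : M.get (e v) = M.node (e v) :=
    (GraphMap.node_of_getElem? (by simp)).symm
  rw [hnode]
  have hlen : (M.node (e v)).adj.length = G.degree v := by rw [h.degree _ (e v).2, he]
  apply List.ext_getElem
  · simp [hlen]
  · intro p h1 h2
    rcases hc : (M.node (e v)).adj[p] with _ | ⟨w, q⟩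
    · have : ((e v : ℕ), p) ∈ M.openPorts :=
        GraphMap.mem_openPorts.2 ⟨(e v).2, List.getElem?_eq_some_iff.2 ⟨h1, hc⟩⟩
      rw [ho] at this
      cases this
    · obtain ⟨h3, h4⟩ := h.adj _ (e v).2 p w q (List.getElem?_eq_some_iff.2 ⟨h1, hc⟩)
      rw [he, P.traverse_of_lt (hlen ▸ h1)] at h4
      simp only [Option.some.injEq, Prod.mk.injEq] at h4
      simp only [List.getElem_ofFn]
      rw [he' w h3 _ h4.1.symm, h4.2]

end PartialMap

end PartialMap

/-! ### Walks along the discovery tree -/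

section Walks

variable {V : Type*} [Fintype V] {G : SimpleGraph V} [DecidableRel G.Adj]

/-- The ports `l`, taken one after the other, lead from `x` to `y`. -/
def IsPath (P : PortLabeling G) : V → List ℕ → V → Prop
  | x, [], y => x = y
  | x, p :: l, y => ∃ z q, P.traverse x p = some (z, q) ∧ IsPath P z l y

/-- The ports in `l` lead from `x` to `y`, and the numbers in `l` are those that `φ` assigns to the
nodes on the way. -/
def IsTour (P : PortLabeling G) (φ : ℕ → V) : V → List (ℕ × ℕ) → V → Prop
  | x, [], y => x = y
  | x, (p, w) :: l, y => (∃ q, P.traverse x p = some (φ w, q)) ∧ IsTour P φ (φ w) l y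

theorem IsPath.append {P : PortLabeling G} {x y z : V} {l l' : List ℕ}
    (h : IsPath P x l y) (h' : IsPath P y l' z) : IsPath P x (l ++ l') z := by
  induction l generalizing x with
  | nil => cases h; exact h'
  | cons p l ih =>
    obtain ⟨u, q, h1, h2⟩ := h
    exact ⟨u, q, h1, ih h2⟩

theorem IsTour.append {P : PortLabeling G} {φ : ℕ → V} {x y z : V} {l l' : List (ℕ × ℕ)}
    (h : IsTour P φ x l y) (h' : IsTour P φ y l' z) : IsTour P φ x (l ++ l') z := by
  induction l generalizing x with
  | nil => cases h; exact h'
  | cons a l ih => exact ⟨h.1, ih h.2⟩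

namespace GraphMap

theorem mem_children {M : GraphMap} {u w : ℕ} :
    w ∈ M.children u ↔ w < M.length ∧ w ≠ 0 ∧ (M.node w).parent = u := by
  simp [children]

/-- The nodes properly below `u` in the discovery tree, in depth-first order (the first argument
bounds the depth). -/
def below (M : GraphMap) : ℕ → ℕ → List ℕ
  | 0, _ => []
  | f + 1, u => (M.children u).flatMap fun w => w :: below M f w

theorem length_tourFrom (M : GraphMap) (f u : ℕ) :
    (M.tourFrom f u).length = 2 * (M.below f u).length := by
  induction f generalizing u with
  | zero => rfl
  | succ f ih =>
    simp only [tourFrom, below]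
    induction M.children u with
    | nil => rfl
    | cons c l ihl =>
      simp only [List.flatMap_cons, List.length_append, List.length_cons, List.length_nil, ihl, ih]
      ring

theorem lt_length_of_mem_tourFrom {M : GraphMap} (f u : ℕ) (hu : u < M.length) :
    ∀ a ∈ M.tourFrom f u, a.2 < M.length := by
  induction f generalizing u with
  | zero => simp [GraphMap.tourFrom]
  | succ f ih =>
    intro a ha
    simp only [GraphMap.tourFrom, List.mem_flatMap, List.cons_append, List.mem_cons,
      List.mem_append, List.not_mem_nil, or_false] at ha
    obtain ⟨c, hc, rfl | ha | rfl⟩ := ha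
    · exact (mem_children.1 hc).1
    · exact ih c (mem_children.1 hc).1 a ha
    · exact hu

/-- With enough fuel, the tour visits the children of all nodes that it visits. -/
theorem mem_tourFrom_succ {M : GraphMap} {f u v w : ℕ} (hw : w ∈ M.children v)
    (hv : v = u ∨ v ∈ (M.tourFrom f u).map Prod.snd) :
    w ∈ (M.tourFrom (f + 1) u).map Prod.snd := by
  induction f generalizing u with
  | zero =>
    rcases hv with rfl | hv
    · simp only [GraphMap.tourFrom, List.mem_map, List.mem_flatMap]
      exact ⟨_, ⟨w, hw, List.mem_cons_self⟩, rfl⟩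
    · simp [GraphMap.tourFrom] at hv
  | succ f ih =>
    have hroot : v = u → w ∈ (M.tourFrom (f + 2) u).map Prod.snd := by
      rintro rfl
      rw [GraphMap.tourFrom]
      simp only [List.mem_map, List.mem_flatMap]
      exact ⟨_, ⟨w, hw, List.mem_cons_self⟩, rfl⟩
    rcases hv with hv | hv
    · exact hroot hv
    · rw [GraphMap.tourFrom] at hv
      simp only [List.mem_map, List.mem_flatMap, List.cons_append, List.mem_cons,
        List.mem_append, List.not_mem_nil, or_false] at hv
      obtain ⟨a, ⟨c, hc, rfl | ha | rfl⟩, rfl⟩ := hv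
      · have := ih (u := c) (Or.inl rfl)
        rw [GraphMap.tourFrom]
        simp only [List.mem_map, List.mem_flatMap] at this ⊢
        obtain ⟨b, hb, rfl⟩ := this
        exact ⟨b, ⟨c, hc, by simp [hb]⟩, rfl⟩
      · have := ih (u := c) (Or.inr (List.mem_map_of_mem ha))
        rw [GraphMap.tourFrom]
        simp only [List.mem_map, List.mem_flatMap] at this ⊢
        obtain ⟨b, hb, rfl⟩ := this
        exact ⟨b, ⟨c, hc, by simp [hb]⟩, rfl⟩
      · exact hroot rfl

theorem count_children {M : GraphMap} {u w : ℕ} (hw : w < M.length) (h0 : w ≠ 0) :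
    (M.children u).count w = if (M.node w).parent = u then 1 else 0 := by
  have hn : (M.children u).Nodup := List.Nodup.filter _ List.nodup_range
  rw [hn.count]
  simp [mem_children, hw, h0]

theorem count_flatMap_cons (l : List ℕ) (g : ℕ → List ℕ) (w : ℕ) :
    (l.flatMap fun c => c :: g c).count w = l.count w + (l.map fun c => (g c).count w).sum := by
  induction l with
  | nil => rfl
  | cons c l ih =>
    simp only [List.flatMap_cons, List.cons_append, List.count_cons, List.count_append, ih,
      List.map_cons, List.sum_cons]
    ring

/-- A node occurs in the depth-first order as often as its parent. -/
theorem count_below_succ {M : GraphMap} {f u w : ℕ} (hw : w < M.length) (h0 : w ≠ 0) :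
    (M.below (f + 1) u).count w =
      (if (M.node w).parent = u then 1 else 0) + (M.below f u).count (M.node w).parent := by
  induction f generalizing u with
  | zero => simp [GraphMap.below, count_children hw h0]
  | succ f ih =>
    rw [GraphMap.below, count_flatMap_cons, count_children hw h0]
    simp only [ih]
    rw [GraphMap.below, count_flatMap_cons, List.sum_map_add]
    congr 2
    induction M.children u with
    | nil => rfl
    | cons c l ihl =>
      simp only [List.map_cons, List.sum_cons, List.count_cons, ihl, beq_iff_eq]
      rw [add_comm]
      simp only [eq_comm]

end GraphMap

namespace PartialMap

variable {P : PortLabeling G} {r : V} {M : GraphMap} {φ : ℕ → V}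

theorem isPath_descend (h : PartialMap P r M φ) {f v : ℕ} (hv : v < M.length) (hf : v < f) :
    IsPath P r (M.descend f v) (φ v) := by
  induction f generalizing v with
  | zero => omega
  | succ f ih =>
    rw [GraphMap.descend]
    split
    · next h0 => subst h0; exact h.root.symm
    · next h0 =>
      obtain ⟨h1, h2⟩ := h.tree v hv h0
      exact (ih (h1.trans hv) (by omega)).append ⟨_, _, h2, rfl⟩

theorem isPath_ascend (h : PartialMap P r M φ) {f v : ℕ} (hv : v < M.length) (hf : v < f) :
    IsPath P (φ v) (M.ascend f v) r := by
  induction f generalizing v with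
  | zero => omega
  | succ f ih =>
    rw [GraphMap.ascend]
    split
    · next h0 => subst h0; exact h.root
    · next h0 =>
      obtain ⟨h1, h2⟩ := h.tree v hv h0
      exact ⟨_, _, P.traverse_symm h2, ih (h1.trans hv) (by omega)⟩

theorem length_descend_le (h : PartialMap P r M φ) {f v : ℕ} (hv : v < M.length) :
    (M.descend f v).length ≤ v := by
  induction f generalizing v with
  | zero => simp [GraphMap.descend]
  | succ f ih =>
    rw [GraphMap.descend]
    split
    · simp
    · next h0 =>
      have h1 := (h.tree v hv h0).1
      have := ih (h1.trans hv)
      simp only [List.length_append, List.length_singleton]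
      omega

theorem length_ascend_le (h : PartialMap P r M φ) {f v : ℕ} (hv : v < M.length) :
    (M.ascend f v).length ≤ v := by
  induction f generalizing v with
  | zero => simp [GraphMap.ascend]
  | succ f ih =>
    rw [GraphMap.ascend]
    split
    · simp
    · next h0 =>
      have h1 := (h.tree v hv h0).1
      have := ih (h1.trans hv)
      simp only [List.length_cons]
      omega

theorem isTour_tourFrom (h : PartialMap P r M φ) (f u : ℕ) :
    IsTour P φ (φ u) (M.tourFrom f u) (φ u) := by
  induction f generalizing u with
  | zero => rfl
  | succ f ih =>
    rw [GraphMap.tourFrom]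
    have hc : ∀ c ∈ M.children u, c < M.length ∧ c ≠ 0 ∧ (M.node c).parent = u := fun c hc =>
      GraphMap.mem_children.1 hc
    generalize M.children u = l at hc ⊢
    induction l with
    | nil => rfl
    | cons c l ihl =>
      rw [List.flatMap_cons]
      refine IsTour.append ?_ (ihl fun c' hc' => hc c' (List.mem_cons_of_mem _ hc'))
      obtain ⟨h1, h2, rfl⟩ := hc c List.mem_cons_self
      have ht := (h.tree c h1 h2).2
      exact IsTour.append (l := _ :: _) ⟨⟨_, ht⟩, ih c⟩ ⟨⟨_, P.traverse_symm ht⟩, rfl⟩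

theorem mem_tourFrom (h : PartialMap P r M φ) {f w : ℕ} (hw : w < M.length) (hf : w ≤ f)
    (h0 : w ≠ 0) : w ∈ (M.tourFrom f 0).map Prod.snd := by
  induction f generalizing w with
  | zero => omega
  | succ f ih =>
    have h1 := (h.tree w hw h0).1
    refine GraphMap.mem_tourFrom_succ (GraphMap.mem_children.2 ⟨hw, h0, rfl⟩) ?_
    by_cases hp : (M.node w).parent = 0
    · exact Or.inl hp
    · exact Or.inr (ih (h1.trans hw) (by omega) hp)

theorem zero_mem_tourFrom (h : PartialMap P r M φ) (f : ℕ) (hl : 1 < M.length) :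
    0 ∈ (M.tourFrom (f + 1) 0).map Prod.snd := by
  have hp : (M.node 1).parent = 0 := by
    have := (h.tree 1 hl one_ne_zero).1
    omega
  have hc : 1 ∈ M.children 0 := GraphMap.mem_children.2 ⟨hl, one_ne_zero, hp⟩
  rw [GraphMap.tourFrom]
  simp only [List.mem_map, List.mem_flatMap]
  exact ⟨((M.node 1).up, 0), ⟨1, hc, by simp⟩, rfl⟩

/-- The tour of a map with at least two nodes visits all of its nodes. -/
theorem mem_tour (h : PartialMap P r M φ) (hl : 1 < M.length) {w : ℕ} (hw : w < M.length) :
    w ∈ M.tour.map Prod.snd := by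
  unfold GraphMap.tour
  by_cases h0 : w = 0
  · subst h0
    obtain ⟨f, hf⟩ : ∃ f, M.length = f + 1 := ⟨M.length - 1, by omega⟩
    rw [hf]
    exact h.zero_mem_tourFrom f hl
  · exact h.mem_tourFrom hw hw.le h0

theorem below_lt (h : PartialMap P r M φ) {f u w : ℕ} (hw : w ∈ M.below f u) :
    u < w ∧ w < M.length := by
  induction f generalizing u with
  | zero => simp [GraphMap.below] at hw
  | succ f ih =>
    simp only [GraphMap.below, List.mem_flatMap, List.mem_cons] at hw
    obtain ⟨c, hc, hw⟩ := hw
    obtain ⟨h1, h2, rfl⟩ := GraphMap.mem_children.1 hc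
    have h3 := (h.tree c h1 h2).1
    rcases hw with rfl | hw
    · exact ⟨h3, h1⟩
    · exact ⟨h3.trans (ih hw).1, (ih hw).2⟩

theorem count_below_le_one (h : PartialMap P r M φ) (f u w : ℕ) :
    (M.below f u).count w ≤ 1 := by
  induction f generalizing w with
  | zero => simp [GraphMap.below]
  | succ f ih =>
    by_cases hw : w < M.length ∧ w ≠ 0
    · rw [GraphMap.count_below_succ hw.1 hw.2]
      split
      · next hp =>
        rw [hp, List.count_eq_zero_of_not_mem fun hu => lt_irrefl _ (h.below_lt hu).1]
      · simpa using ih _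
    · rw [List.count_eq_zero_of_not_mem]
      · simp
      · intro hm
        have := h.below_lt hm
        omega

theorem length_tour_le (h : PartialMap P r M φ) : M.tour.length ≤ 2 * (M.length - 1) := by
  rw [GraphMap.tour, GraphMap.length_tourFrom]
  have hn : (M.below M.length 0).Nodup := List.nodup_iff_count_le_one.2 (h.count_below_le_one _ _)
  have hs : (M.below M.length 0).toFinset ⊆ Finset.Ico 1 M.length := fun w hw => by
    have := h.below_lt (List.mem_toFinset.1 hw)
    exact Finset.mem_Ico.2 ⟨this.1, this.2⟩
  have := Finset.card_le_card hs
  rw [List.toFinset_card_of_nodup hn, Nat.card_Ico] at this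
  omega

theorem isTour_tour (h : PartialMap P r M φ) : IsTour P φ r M.tour r := by
  have := h.isTour_tourFrom M.length 0
  rwa [h.root] at this

end PartialMap

end Walks

/-! ### Exploring one port -/

section Exploration

variable {V : Type*} [Fintype V] {G : SimpleGraph V} [DecidableRel G.Adj]

/-- The first part of an exploration walk: the token is taken to the unknown node. -/
def outwardWalk (M : GraphMap) (v p : ℕ) : List Move :=
  (M.descend M.length v).map (fun x => ⟨x, true, none⟩) ++ [⟨p, true, none⟩]

/-- An exploration walk after its first part. -/
def searchWalk (M : GraphMap) (v p q : ℕ) : List Move :=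
  ([⟨q, false, none⟩] ++ (M.ascend M.length v).map (fun x => ⟨x, false, none⟩)) ++
  M.tour.map (fun x => ⟨x.1, false, some x.2⟩) ++
  ((M.descend M.length v).map (fun x => ⟨x, false, none⟩) ++ [⟨p, false, none⟩]) ++
  ([⟨q, true, none⟩] ++ (M.ascend M.length v).map (fun x => ⟨x, true, none⟩))

theorem explorationWalk_eq (M : GraphMap) (v p q : ℕ) :
    explorationWalk M v p q = outwardWalk M v p ++ searchWalk M v p q := by
  simp [explorationWalk, outwardWalk, searchWalk]

theorem length_outwardWalk (M : GraphMap) (v p : ℕ) :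
    (outwardWalk M v p).length = (M.descend M.length v).length + 1 := by
  simp [outwardWalk]

theorem length_searchWalk (M : GraphMap) (v p q : ℕ) :
    (searchWalk M v p q).length =
      2 * (M.ascend M.length v).length + M.tour.length + (M.descend M.length v).length + 3 := by
  simp only [searchWalk, List.length_append, List.length_map, List.length_cons, List.length_nil]
  ring

theorem length_explorationWalk (M : GraphMap) (v p q q' : ℕ) :
    (explorationWalk M v p q).length = (explorationWalk M v p q').length := by
  simp only [explorationWalk_eq, List.length_append, length_searchWalk]

/-- Before the unknown node is reached, the exploration walk does not depend on the port of entry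
there. -/
theorem getElem?_explorationWalk_of_le (M : GraphMap) {v p k : ℕ} (q : ℕ)
    (hk : k ≤ (M.descend M.length v).length) :
    (explorationWalk M v p q)[k]? = (outwardWalk M v p)[k]? := by
  rw [explorationWalk_eq, List.getElem?_append_left]
  rw [length_outwardWalk]
  omega

namespace PartialMap

variable {P : PortLabeling G} {r : V} {M : GraphMap} {φ : ℕ → V}

theorem length_explorationWalk_le (h : PartialMap P r M φ) {v : ℕ} (hv : v < M.length) (p q : ℕ) :
    (explorationWalk M v p q).length ≤ 6 * Fintype.card V - 2 := by
  rw [explorationWalk_eq, List.length_append, length_outwardWalk, length_searchWalk]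
  have h1 := h.length_descend_le hv (f := M.length)
  have h2 := h.length_ascend_le hv (f := M.length)
  have h3 := h.length_tour_le
  have h4 := h.length_le
  omega

theorem goal_lt_of_mem_explorationWalk (h : PartialMap P r M φ) {v p q : ℕ} {m : Move}
    (hm : m ∈ explorationWalk M v p q) : ∀ w, m.goal = some w → w < M.length := by
  simp only [explorationWalk, List.mem_append, List.mem_map, List.mem_singleton] at hm
  intro w hw
  rcases hm with ((((⟨_, _, rfl⟩ | rfl) | (rfl | ⟨_, _, rfl⟩)) | ⟨a, ha, rfl⟩) |
    (⟨_, _, rfl⟩ | rfl)) | (rfl | ⟨_, _, rfl⟩) <;> cases hw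
  exact GraphMap.lt_length_of_mem_tourFrom _ 0 h.length_pos a ha

end PartialMap

variable [DecidableEq V]

/-- The effect of a move on the position of the explorer, the position of the token, and the known
node at which the token has been seen. -/
def moveEffect (P : PortLabeling G) (c : V × V × Option ℕ) (m : Move) : V × V × Option ℕ :=
  let x := ((P.traverse c.1 m.port).map Prod.fst).getD c.1
  let y := if m.carry = true ∧ c.1 = c.2.1 then x else c.2.1
  (x, y, m.goal.elim c.2.2 fun w => if x = y then some w else c.2.2)

theorem foldl_moveEffect_alone {P : PortLabeling G} {x y t : V} {hit : Option ℕ} {l : List ℕ}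
    (h : IsPath P x l y) :
    (l.map fun a => (⟨a, false, none⟩ : Move)).foldl (moveEffect P) (x, t, hit) = (y, t, hit) := by
  induction l generalizing x with
  | nil => cases h; rfl
  | cons p l ih =>
    obtain ⟨z, q, h1, h2⟩ := h
    rw [List.map_cons, List.foldl_cons, ← ih h2]
    simp [moveEffect, h1]

theorem foldl_moveEffect_carry {P : PortLabeling G} {x y : V} {hit : Option ℕ} {l : List ℕ}
    (h : IsPath P x l y) :
    (l.map fun a => (⟨a, true, none⟩ : Move)).foldl (moveEffect P) (x, x, hit) = (y, y, hit) := by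
  induction l generalizing x with
  | nil => cases h; rfl
  | cons p l ih =>
    obtain ⟨z, q, h1, h2⟩ := h
    rw [List.map_cons, List.foldl_cons, ← ih h2]
    simp [moveEffect, h1]

theorem foldl_moveEffect_tour {P : PortLabeling G} {φ : ℕ → V} {x y t : V} {hit : Option ℕ}
    {l : List (ℕ × ℕ)} (h : IsTour P φ x l y) :
    ∃ hit', (l.map fun a => (⟨a.1, false, some a.2⟩ : Move)).foldl (moveEffect P) (x, t, hit) =
        (y, t, hit') ∧
      (∀ w, hit' = some w → hit = some w ∨ w ∈ l.map Prod.snd ∧ φ w = t) ∧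
      (hit' = none → hit = none ∧ ∀ w ∈ l.map Prod.snd, φ w ≠ t) := by
  induction l generalizing x hit with
  | nil => cases h; exact ⟨hit, rfl, fun w hw => Or.inl hw, fun hn => ⟨hn, by simp⟩⟩
  | cons a l ih =>
    obtain ⟨p, w⟩ := a
    obtain ⟨⟨q, h1⟩, h2⟩ := h
    obtain ⟨hit', e, hs, hn⟩ := ih (hit := if φ w = t then some w else hit) h2
    refine ⟨hit', ?_, fun u hu => ?_, fun hh => ?_⟩
    · rw [List.map_cons, List.foldl_cons, ← e]
      simp [moveEffect, h1]
    · rcases hs u hu with hu | hu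
      · split at hu
        · next ht =>
          cases hu
          exact Or.inr ⟨by simp, ht⟩
        · exact Or.inl hu
      · exact Or.inr ⟨by simp only [List.map_cons, List.mem_cons]; exact Or.inr hu.1, hu.2⟩
    · obtain ⟨h3, h4⟩ := hn hh
      split at h3
      · cases h3
      · next ht =>
        refine ⟨h3, ?_⟩
        simp only [List.map_cons, List.mem_cons]
        rintro u (rfl | hu)
        · exact ht
        · exact h4 u hu

namespace PartialMap

variable {P : PortLabeling G} {r : V} {M : GraphMap} {φ : ℕ → V}

theorem foldl_outwardWalk (h : PartialMap P r M φ) {v p q : ℕ} {x : V} (hv : v < M.length)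
    (ht : P.traverse (φ v) p = some (x, q)) :
    (outwardWalk M v p).foldl (moveEffect P) (r, r, none) = (x, x, none) := by
  rw [outwardWalk, List.foldl_append, foldl_moveEffect_carry (h.isPath_descend hv hv)]
  simp [moveEffect, ht]

theorem foldl_explorationWalk (h : PartialMap P r M φ) {v p q : ℕ} {x : V} (hv : v < M.length)
    (ht : P.traverse (φ v) p = some (x, q)) :
    ∃ hit, (explorationWalk M v p q).foldl (moveEffect P) (r, r, none) = (r, r, hit) ∧
      (∀ w, hit = some w → w < M.length ∧ φ w = x) ∧
      (hit = none → ∀ w < M.length, φ w ≠ x) := by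
  have hup : IsPath P x ([q] ++ M.ascend M.length v) r :=
    IsPath.append ⟨_, _, P.traverse_symm ht, rfl⟩ (h.isPath_ascend hv hv)
  have hdown : IsPath P r (M.descend M.length v ++ [p]) x :=
    (h.isPath_descend hv hv).append ⟨_, _, ht, rfl⟩
  obtain ⟨hit, e, hs, hn⟩ := foldl_moveEffect_tour (t := x) (hit := none) h.isTour_tour
  refine ⟨hit, ?_, fun w hw => ?_, fun hh w hw => ?_⟩
  · have e1 := foldl_moveEffect_alone (t := x) (hit := none) hup
    have e2 := foldl_moveEffect_alone (t := x) (hit := hit) hdown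
    have e3 := foldl_moveEffect_carry (hit := hit) hup
    simp only [List.map_append, List.map_cons, List.map_nil, List.foldl_append] at e1 e2 e3
    simp only [explorationWalk_eq, List.foldl_append, h.foldl_outwardWalk hv ht, searchWalk, e1, e,
      e2, e3]
  · rcases hs w hw with hw | ⟨hw, hx⟩
    · cases hw
    · obtain ⟨a, ha, rfl⟩ := List.mem_map.1 hw
      exact ⟨GraphMap.lt_length_of_mem_tourFrom _ 0 h.length_pos a ha, hx⟩
  · by_cases hl : 1 < M.length
    · exact (hn hh).2 w (h.mem_tour hl hw)
    · -- the only known node is the one that the explored edge leaves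
      obtain rfl : w = v := by omega
      exact P.ne_of_traverse ht

end PartialMap

theorem foldl_moveEffect_hit {P : PortLabeling G} {N : ℕ} (l : List Move)
    (hl : ∀ m ∈ l, ∀ w, m.goal = some w → w < N) (c : V × V × Option ℕ)
    (hc : ∀ w, c.2.2 = some w → w < N) :
    ∀ w, (l.foldl (moveEffect P) c).2.2 = some w → w < N := by
  induction l generalizing c with
  | nil => exact hc
  | cons m l ih =>
    refine ih (fun m' hm' => hl m' (List.mem_cons_of_mem _ hm')) _ fun w hw => ?_
    simp only [moveEffect] at hw
    rcases hg : m.goal with _ | u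
    · rw [hg] at hw; exact hc w hw
    · rw [hg] at hw
      simp only [Option.elim_some] at hw
      rcases ite_eq_iff.1 hw with ⟨_, hw⟩ | ⟨_, hw⟩
      · cases hw; exact hl m List.mem_cons_self _ hg
      · exact hc w hw

end Exploration

/-! ### The exploration of the whole graph -/

section Solo

variable {V : Type*}

/-- A finder together with its token: the survey as updated by the present observations, the
position of the finder, and the position of the token. -/
structure SoloState (V : Type*) where
  survey : Survey
  pos : V
  token : V

/-- The survey at the beginning of the exploration of a port. -/
def Survey.fresh (M : GraphMap) : Survey := ⟨M, 0, 0, 0, none⟩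

theorem Survey.walk_eq {s : Survey} {v p : ℕ} (h : s.map.openPorts.head? = some (v, p)) :
    s.walk = explorationWalk s.map v p s.q := by
  simp [Survey.walk, h]

theorem Survey.walk_eq_nil {s : Survey} (h : s.map.openPorts = []) : s.walk = [] := by
  simp [Survey.walk, h]

theorem length_explorationWalk_pos (M : GraphMap) (v p q : ℕ) :
    (M.descend M.length v).length + 1 < (explorationWalk M v p q).length := by
  rw [explorationWalk_eq, List.length_append, length_outwardWalk, length_searchWalk]
  omega

theorem Survey.update_fresh (M : GraphMap) (d : ℕ) (e : Option ℕ) (t : Bool) :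
    (Survey.fresh M).update d e t = Survey.fresh M := by
  rcases h : M.openPorts.head? with _ | ⟨v, p⟩
  · simp [Survey.update, Survey.arrive, Survey.conclude, Survey.fresh, h]
  · have := length_explorationWalk_pos M v p 0
    have h0 : 0 ≠ (explorationWalk M v p 0).length := by omega
    simp [Survey.update, Survey.arrive, Survey.conclude, Survey.fresh, h, Survey.walk, h0]

variable [Fintype V] [DecidableEq V] {G : SimpleGraph V} [DecidableRel G.Adj]

/-- One round of a finder with its token, in the absence of other robots. -/
def soloStep (P : PortLabeling G) (c : SoloState V) : SoloState V :=
  let t := (c.survey.nextMove.map Move.port).bind (P.traverse c.pos)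
  let x := (t.map Prod.fst).getD c.pos
  let y := if c.pos = c.token then
    (((c.survey.nextMove.bind fun m => if m.carry then some m.port else none).bind
      (P.traverse c.pos)).map Prod.fst).getD c.token else c.token
  ⟨c.survey.advance.update (G.degree x) (t.map Prod.snd) (decide (x = y)), x, y⟩

theorem soloStep_eq (P : PortLabeling G) (c : SoloState V) : soloStep P c =
    ⟨c.survey.advance.update (G.degree (soloStep P c).pos)
      (((c.survey.nextMove.map Move.port).bind (P.traverse c.pos)).map Prod.snd)
      (decide ((soloStep P c).pos = (soloStep P c).token)),
      (soloStep P c).pos, (soloStep P c).token⟩ := rfl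

/-- The finder is on its way to explore port `p` of node `v` of its map `M`, which leads to the node
`x` of the graph and enters it through port `q`. -/
structure Exploring (P : PortLabeling G) (r : V) (c : SoloState V) (M : GraphMap) (φ : ℕ → V)
    (v p q : ℕ) (x : V) : Prop where
  map : PartialMap P r M φ
  head : M.openPorts.head? = some (v, p)
  edge : P.traverse (φ v) p = some (x, q)
  survey_map : c.survey.map = M
  pc_lt : c.survey.pc < (explorationWalk M v p q).length
  q_eq : c.survey.q = if c.survey.pc ≤ (M.descend M.length v).length then 0 else q
  d_eq : c.survey.d = if c.survey.pc ≤ (M.descend M.length v).length then 0 else G.degree x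
  effect : (c.pos, c.token, c.survey.hit) =
    ((explorationWalk M v p q).take c.survey.pc).foldl (moveEffect P) (r, r, none)

/-- The map of the finder is complete, and the finder and its token are at the root. -/
def Complete (P : PortLabeling G) (r : V) (c : SoloState V) : Prop :=
  ∃ M φ, PartialMap P r M φ ∧ M.openPorts = [] ∧ c = ⟨Survey.fresh M, r, r⟩

theorem complete_or_exploring_fresh {P : PortLabeling G} {r : V} {M : GraphMap} {φ : ℕ → V}
    (h : PartialMap P r M φ) : Complete P r ⟨Survey.fresh M, r, r⟩ ∨
      ∃ v p q x, Exploring P r ⟨Survey.fresh M, r, r⟩ M φ v p q x := by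
  rcases ho : M.openPorts.head? with _ | ⟨v, p⟩
  · exact Or.inl ⟨M, φ, h, by simpa using ho, rfl⟩
  · right
    obtain ⟨hv, hp⟩ := GraphMap.mem_openPorts.1 (List.mem_of_head? ho)
    have hlt : p < G.degree (φ v) := by
      rw [← h.degree v hv]; exact (List.getElem?_eq_some_iff.1 hp).1
    refine ⟨v, p, _, _, h, ho, P.traverse_of_lt hlt, rfl, ?_, ?_, ?_, ?_⟩
    · exact (Nat.zero_lt_succ _).trans (length_explorationWalk_pos M v p _)
    · simp [Survey.fresh]
    · simp [Survey.fresh]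
    · simp [Survey.fresh]

theorem Complete.soloStep {P : PortLabeling G} {r : V} {c : SoloState V} (h : Complete P r c) :
    soloStep P c = c := by
  obtain ⟨M, φ, -, ho, rfl⟩ := h
  have hw : (Survey.fresh M).walk = [] := Survey.walk_eq_nil ho
  have hn : (Survey.fresh M).nextMove = none := by simp [Survey.nextMove, hw]
  have ha : (Survey.fresh M).advance = Survey.fresh M := by simp [Survey.advance, hn]
  simp [RobotGathering.soloStep, hn, ha, Survey.update_fresh]

namespace Exploring

variable {P : PortLabeling G} {r : V} {c : SoloState V} {M : GraphMap} {φ : ℕ → V} {v p q : ℕ}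
  {x : V}

theorem mem_openPorts (h : Exploring P r c M φ v p q x) : (v, p) ∈ M.openPorts :=
  List.mem_of_head? h.head

theorem lt_length (h : Exploring P r c M φ v p q x) : v < M.length :=
  (GraphMap.mem_openPorts.1 h.mem_openPorts).1

theorem nextMove_eq (h : Exploring P r c M φ v p q x) :
    c.survey.nextMove = some ((explorationWalk M v p q)[c.survey.pc]'h.pc_lt) := by
  have hh := h.head
  rw [← h.survey_map] at hh
  rw [Survey.nextMove, Survey.walk_eq hh, h.survey_map, h.q_eq, ← List.getElem?_eq_getElem]
  split
  · next hk =>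
    rw [getElem?_explorationWalk_of_le M 0 hk, getElem?_explorationWalk_of_le M q hk]
  · rfl

theorem advance_eq (h : Exploring P r c M φ v p q x) :
    c.survey.advance = { c.survey with pc := c.survey.pc + 1 } := by
  simp [Survey.advance, h.nextMove_eq]

theorem effect_succ (h : Exploring P r c M φ v p q x) :
    ((explorationWalk M v p q).take (c.survey.pc + 1)).foldl (moveEffect P) (r, r, none) =
      moveEffect P (c.pos, c.token, c.survey.hit) ((explorationWalk M v p q)[c.survey.pc]'h.pc_lt)
      := by
  rw [h.effect, List.take_add_one, List.getElem?_eq_getElem h.pc_lt, List.foldl_append]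
  rfl

theorem pos_soloStep (h : Exploring P r c M φ v p q x) :
    (soloStep P c).pos = (((explorationWalk M v p q).take (c.survey.pc + 1)).foldl (moveEffect P)
      (r, r, none)).1 := by
  rw [h.effect_succ]
  simp [soloStep, h.nextMove_eq, moveEffect]

theorem token_soloStep (h : Exploring P r c M φ v p q x) :
    (soloStep P c).token = (((explorationWalk M v p q).take (c.survey.pc + 1)).foldl (moveEffect P)
      (r, r, none)).2.1 := by
  rw [h.effect_succ]
  simp only [soloStep, h.nextMove_eq, moveEffect, Option.bind_some]
  by_cases hm : c.pos = c.token
  · by_cases hc : ((explorationWalk M v p q)[c.survey.pc]'h.pc_lt).carry = true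
    · simp [hm, hc]
    · simp [hm, hc]
  · simp [hm]

/-- The survey on arrival at the next node, apart from the extension of the map that takes place at
the end of the walk. -/
theorem arrive_eq (h : Exploring P r c M φ v p q x) {e : Option ℕ}
    (he : e = ((P.traverse c.pos ((explorationWalk M v p q)[c.survey.pc]'h.pc_lt).port).map
      Prod.snd)) :
    c.survey.advance.arrive (G.degree (soloStep P c).pos) e
        (decide ((soloStep P c).pos = (soloStep P c).token)) =
      ⟨M, c.survey.pc + 1,
        if c.survey.pc + 1 ≤ (M.descend M.length v).length then 0 else q,
        if c.survey.pc + 1 ≤ (M.descend M.length v).length then 0 else G.degree x,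
        (((explorationWalk M v p q).take (c.survey.pc + 1)).foldl (moveEffect P)
          (r, r, none)).2.2⟩ := by
  have hv := h.lt_length
  have hmap := h.survey_map
  have hx := h.pos_soloStep
  have hy := h.token_soloStep
  have hstep := h.effect_succ
  rw [h.advance_eq]
  unfold Survey.arrive
  simp only [hmap, h.head]
  by_cases h1 : c.survey.pc = (M.descend M.length v).length
  · -- the move through the unexplored port
    have htake : (explorationWalk M v p q).take (c.survey.pc + 1) = outwardWalk M v p := by
      rw [explorationWalk_eq, h1, ← length_outwardWalk M v p, List.take_left]
    have hmove : (explorationWalk M v p q)[c.survey.pc]'h.pc_lt = ⟨p, true, none⟩ := by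
      rw [← Option.some_inj, ← List.getElem?_eq_getElem,
        getElem?_explorationWalk_of_le M q h1.le, outwardWalk,
        List.getElem?_append_right (by simp [h1])]
      simp [h1]
    have hpos : c.pos = φ v := by
      have h2 := congrArg Prod.fst h.effect
      rw [explorationWalk_eq, outwardWalk, h1, List.append_assoc,
        List.take_left' (by simp), foldl_moveEffect_carry (h.map.isPath_descend hv hv)] at h2
      exact h2
    rw [htake, h.map.foldl_outwardWalk hv h.edge] at hx ⊢
    rw [hmove, hpos, h.edge] at he
    have hhit : c.survey.hit = none := by
      have h2 := congrArg (fun z => z.2.2) hstep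
      rw [htake, h.map.foldl_outwardWalk hv h.edge] at h2
      rw [hmove] at h2
      simpa [moveEffect] using h2.symm
    have hd : G.degree (soloStep P c).pos = G.degree x := congrArg (fun z => G.degree z) hx
    simp [h1, he, hd, hhit]
  · have h1' : ¬ c.survey.pc + 1 = (M.descend M.length v).length + 1 := by omega
    have hiff : c.survey.pc + 1 ≤ (M.descend M.length v).length ↔
        c.survey.pc ≤ (M.descend M.length v).length := by omega
    have hwalk : (⟨M, c.survey.pc + 1, c.survey.q, c.survey.d, c.survey.hit⟩ : Survey).walk[
        c.survey.pc + 1 - 1]? = some ((explorationWalk M v p q)[c.survey.pc]'h.pc_lt) := by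
      rw [← h.nextMove_eq, Survey.nextMove]
      simp [Survey.walk, hmap]
    simp only [if_neg h1', if_neg (Nat.succ_ne_zero c.survey.pc), hwalk, Option.bind_some, hiff]
    rw [hx, hy, hstep]
    rw [← h.q_eq, ← h.d_eq]
    rcases hg : ((explorationWalk M v p q)[c.survey.pc]'h.pc_lt).goal with _ | w
    · simp [moveEffect, hg]
    · simp only [moveEffect, hg, Option.elim_some, decide_eq_true_eq]
      split_ifs <;> rfl

theorem survey_soloStep (h : Exploring P r c M φ v p q x) :
    (soloStep P c).survey = Survey.conclude ⟨M, c.survey.pc + 1,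
        if c.survey.pc + 1 ≤ (M.descend M.length v).length then 0 else q,
        if c.survey.pc + 1 ≤ (M.descend M.length v).length then 0 else G.degree x,
        (((explorationWalk M v p q).take (c.survey.pc + 1)).foldl (moveEffect P)
          (r, r, none)).2.2⟩ := by
  rw [← h.arrive_eq (e := ((c.survey.nextMove.map Move.port).bind (P.traverse c.pos)).map Prod.snd)
    (by simp [h.nextMove_eq])]
  rfl

theorem soloStep_of_lt (h : Exploring P r c M φ v p q x)
    (hk : c.survey.pc + 1 < (explorationWalk M v p q).length) :
    Exploring P r (soloStep P c) M φ v p q x ∧ (soloStep P c).survey.pc = c.survey.pc + 1 := by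
  have hs := h.survey_soloStep
  rw [Survey.conclude] at hs
  simp only [h.head] at hs
  rw [if_neg] at hs
  · refine ⟨⟨h.map, h.head, h.edge, by rw [hs], by rw [hs]; exact hk, by rw [hs], by rw [hs], ?_⟩,
      by rw [hs]⟩
    rw [h.pos_soloStep, h.token_soloStep, hs]
  · rw [Survey.walk_eq (s := ⟨_, _, _, _, _⟩) h.head]
    rw [length_explorationWalk M v p _ q]
    exact hk.ne

/-- The last move of an exploration walk extends the map. -/
theorem soloStep_of_eq (h : Exploring P r c M φ v p q x)
    (hk : c.survey.pc + 1 = (explorationWalk M v p q).length) :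
    ∃ M' φ', PartialMap P r M' φ' ∧ M.explored < M'.explored ∧
      soloStep P c = ⟨Survey.fresh M', r, r⟩ := by
  have hv := h.lt_length
  obtain ⟨hit, e, hs, hn⟩ := h.map.foldl_explorationWalk hv h.edge
  obtain ⟨φ', h'⟩ := h.map.extend hv h.edge hs hn
  refine ⟨_, φ', h', GraphMap.explored_lt_extend _ _ _ h.mem_openPorts, ?_⟩
  have hx := h.pos_soloStep
  have hy := h.token_soloStep
  have hsv := h.survey_soloStep
  have hlen := length_explorationWalk_pos M v p q
  rw [hk, List.take_length, e] at hx hy hsv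
  rw [Survey.conclude] at hsv
  simp only [h.head] at hsv
  rw [if_pos, if_neg (by omega), if_neg (by omega)] at hsv
  · rcases hc : soloStep P c with ⟨s, a, b⟩
    rw [hc] at hx hy hsv
    simp only at hx hy hsv
    rw [hx, hy, hsv]
    rfl
  · rw [Survey.walk_eq (s := ⟨_, _, _, _, _⟩) h.head]
    exact length_explorationWalk M v p _ _

end Exploring

/-- The exploration goes on correctly, and has made at least `t` moves if it is not complete: the
potential on the right-hand side counts `6 n - 2` moves for each explored port. -/
def Progress (P : PortLabeling G) (r : V) (c : SoloState V) (t : ℕ) : Prop :=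
  Complete P r c ∨ ∃ M φ v p q x, Exploring P r c M φ v p q x ∧
    t ≤ M.explored * (6 * Fintype.card V - 2) + c.survey.pc

theorem Progress.fresh {P : PortLabeling G} {r : V} {M : GraphMap} {φ : ℕ → V} {t : ℕ}
    (h : PartialMap P r M φ) (ht : t ≤ M.explored * (6 * Fintype.card V - 2)) :
    Progress P r ⟨Survey.fresh M, r, r⟩ t := by
  rcases complete_or_exploring_fresh h with h | ⟨v, p, q, x, h⟩
  · exact Or.inl h
  · exact Or.inr ⟨M, φ, v, p, q, x, h, by omega⟩

theorem Progress.soloStep {P : PortLabeling G} {r : V} {c : SoloState V} {t : ℕ}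
    (h : Progress P r c t) : Progress P r (soloStep P c) (t + 1) := by
  rcases h with h | ⟨M, φ, v, p, q, x, h, ht⟩
  · rw [h.soloStep]
    exact Or.inl h
  · rcases (Nat.succ_le_of_lt h.pc_lt).lt_or_eq with hk | hk
    · obtain ⟨h1, h2⟩ := h.soloStep_of_lt hk
      exact Or.inr ⟨M, φ, v, p, q, x, h1, by omega⟩
    · obtain ⟨M', φ', h1, h2, h3⟩ := h.soloStep_of_eq hk
      rw [h3]
      refine Progress.fresh h1 ?_
      have h4 := h.map.length_explorationWalk_le h.lt_length p q
      have h5 : (M.explored + 1) * (6 * Fintype.card V - 2) ≤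
        M'.explored * (6 * Fintype.card V - 2) := Nat.mul_le_mul_right _ h2
      rw [Nat.add_mul, one_mul] at h5
      simp only [Nat.succ_eq_add_one] at hk
      omega

/-- The first phase is long enough: a graph with `n` nodes has at most `n (n - 1)` ports, so the
potential of an incomplete exploration is at most
`n (n - 1) (6 n - 2) + (6 n - 3) < 6 n ^ 3 - 2`. -/
theorem Progress.complete {P : PortLabeling G} {r : V} {c : SoloState V} {t : ℕ}
    (h : Progress P r c t) (ht : phaseOneLength (Fintype.card V) ≤ t + 2) : Complete P r c := by
  rcases h with h | ⟨M, φ, v, p, q, x, h, hle⟩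
  · exact h
  · exfalso
    have h1 := h.map.explored_le
    have h2 := h.map.length_explorationWalk_le h.lt_length p q
    have h3 := h.pc_lt
    have hn : 2 ≤ Fintype.card V := by
      have := G.degree_lt_card_verts (φ v)
      have := P.lt_degree_of_traverse h.edge
      omega
    obtain ⟨n, hn'⟩ : ∃ n, Fintype.card V = n + 2 := ⟨_, (Nat.sub_add_cancel hn).symm⟩
    rw [hn'] at h1 h2 hle ht
    have h4 := Nat.mul_le_mul_right (6 * (n + 2) - 2) h1
    have e1 : 6 * (n + 2) - 2 = 6 * n + 10 := by omega
    have e2 : n + 2 - 1 = n + 1 := by omega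
    rw [e1] at h4 h2 hle
    rw [e2] at h4
    unfold phaseOneLength at ht
    nlinarith

theorem Progress.exists_partialMap {P : PortLabeling G} {r : V} {c : SoloState V} {t : ℕ}
    (h : Progress P r c t) : ∃ φ, PartialMap P r c.survey.map φ ∧
      c.survey.pc < 6 * Fintype.card V ∧ c.survey.q ≤ Fintype.card V ∧
      c.survey.d ≤ Fintype.card V ∧ ∀ w, c.survey.hit = some w → w ≤ Fintype.card V := by
  rcases h with ⟨M, φ, h, -, rfl⟩ | ⟨M, φ, v, p, q, x, h, -⟩
  · refine ⟨φ, h, ?_, ?_, ?_, ?_⟩ <;> simp [Survey.fresh]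
    exact Fintype.card_pos_iff.2 ⟨r⟩
  · have h2 := h.map.length_explorationWalk_le h.lt_length p q
    have h3 := h.pc_lt
    refine ⟨φ, by rw [h.survey_map]; exact h.map, by omega, ?_, ?_, ?_⟩
    · rw [h.q_eq]
      split
      · omega
      · exact ((P.lt_degree_of_traverse (P.traverse_symm h.edge)).trans
          (G.degree_lt_card_verts x)).le
    · rw [h.d_eq]
      split
      · omega
      · exact (G.degree_lt_card_verts x).le
    · intro w hw
      have he : c.survey.hit = _ := congrArg (fun z => z.2.2) h.effect
      rw [he] at hw
      refine (foldl_moveEffect_hit _ (fun m hm => ?_) _ (by simp) w hw).le.trans h.map.length_le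
      exact h.map.goal_lt_of_mem_explorationWalk (List.mem_of_mem_take hm)

end Solo

/-! ### Messages and least group identifiers -/

theorem least_eq_some_iff {s : Multiset ℕ} {g : ℕ} :
    least s = some g ↔ g ∈ s ∧ ∀ x ∈ s, g ≤ x := by
  have hm : ∀ x, x ∈ s ↔ x ∈ s.sort (· ≤ ·) := fun x => (Multiset.mem_sort _).symm
  have hp := Multiset.pairwise_sort s (· ≤ ·)
  unfold least
  simp only [hm]
  generalize s.sort (· ≤ ·) = l at hp ⊢
  rcases l with _ | ⟨a, l⟩
  · simp
  · rw [List.pairwise_cons] at hp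
    simp only [List.head?_cons, Option.some.injEq, List.mem_cons, forall_eq_or_imp]
    constructor
    · rintro rfl
      exact ⟨Or.inl rfl, le_rfl, hp.1⟩
    · rintro ⟨rfl | hg, h1, -⟩
      · rfl
      · exact le_antisymm (hp.1 g hg) h1

theorem least_eq_none_iff {s : Multiset ℕ} : least s = none ↔ ∀ x, x ∉ s := by
  have hm : ∀ x, x ∈ s ↔ x ∈ s.sort (· ≤ ·) := fun x => (Multiset.mem_sort _).symm
  unfold least
  simp only [hm, List.head?_eq_none_iff, List.eq_nil_iff_forall_not_mem]

/-- If all senders that contribute to a minimum contribute the same value, the minimum is this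
value. -/
theorem least_filterMap {α : Type*} {s : Multiset α} {F : α → Option ℕ} {o : Option ℕ}
    (h : ∀ x ∈ s, F x = none ∨ F x = o) (h' : ∃ x ∈ s, F x = o) : least (s.filterMap F) = o := by
  obtain ⟨a, ha, hF⟩ := h'
  rcases o with _ | g
  · rw [least_eq_none_iff]
    intro x hx
    obtain ⟨b, hb, hbx⟩ := (Multiset.mem_filterMap _ _).1 hx
    rcases h b hb with hn | hn <;> rw [hn] at hbx <;> cases hbx
  · rw [least_eq_some_iff]
    refine ⟨(Multiset.mem_filterMap _ _).2 ⟨a, ha, hF⟩, fun x hx => ?_⟩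
    obtain ⟨b, hb, hbx⟩ := (Multiset.mem_filterMap _ _).1 hx
    rcases h b hb with hn | hn <;> rw [hn] at hbx <;> cases hbx
    exact le_rfl

section Run

variable {V ι : Type*} [Fintype V] [DecidableEq V] [Fintype ι]
  {G : SimpleGraph V} [DecidableRel G.Adj]

omit [Fintype V] in
theorem Config.mem_messages {S : Type} {c : Config V ι S} {v : V} {x : Message S} :
    x ∈ c.messages v ↔ ∃ j, c.pos j = v ∧ (c.state j, c.entry j) = x := by
  simp [Config.messages]

omit [Fintype V] in
theorem Config.card_messages {S : Type} (c : Config V ι S) (v : V) :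
    (c.messages v).card = (Finset.univ.filter fun j => c.pos j = v).card := by
  exact Multiset.card_map _ _

/-- One round of Undispersed-Gathering. -/
def gatheringNext (P : PortLabeling G) (c : Config V ι RobotState) : Config V ι RobotState :=
  undispersedGathering.next P c

/-- The configuration of Undispersed-Gathering after `t` rounds. -/
def gatheringRun (P : PortLabeling G) (ident : ι → ℕ) (start : ι → V) (t : ℕ) :
    Config V ι RobotState := undispersedGathering.run P ident start t

theorem gatheringRun_succ (P : PortLabeling G) (ident : ι → ℕ) (start : ι → V) (t : ℕ) :
    gatheringRun P ident start (t + 1) = gatheringNext P (gatheringRun P ident start t) := rfl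

/-- What robot `i` does in the next round, if it has not terminated. -/
def robotMove (G : SimpleGraph V) [DecidableRel G.Adj] (c : Config V ι RobotState) (i : ι) :
    RobotState × Option ℕ :=
  robotAct (c.state i, c.entry i) (G.degree (c.pos i)) (c.messages (c.pos i))

/-- The robot has not terminated yet. -/
def Running (s : RobotState) : Prop := s.clock ≠ phaseOneLength s.n + 2 * s.n

theorem decision_of_running {c : Config V ι RobotState} {i : ι} (h : Running (c.state i)) :
    undispersedGathering.decision G c i = robotMove G c i := by
  have h' : undispersedGathering.terminated (c.state i) ≠ true := fun h' =>
    h (of_decide_eq_true h')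
  exact if_neg h'

theorem decision_of_not_running {c : Config V ι RobotState} {i : ι} (h : ¬ Running (c.state i)) :
    undispersedGathering.decision G c i = (c.state i, none) := by
  have h' : undispersedGathering.terminated (c.state i) = true := decide_eq_true (not_not.1 h)
  exact if_pos h'

theorem state_gatheringNext {P : PortLabeling G} {c : Config V ι RobotState} {i : ι}
    (h : Running (c.state i)) : (gatheringNext P c).state i = (robotMove G c i).1 := by
  rw [← decision_of_running h]; rfl

theorem pos_gatheringNext {P : PortLabeling G} {c : Config V ι RobotState} {i : ι}
    (h : Running (c.state i)) : (gatheringNext P c).pos i =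
      (((robotMove G c i).2.bind (P.traverse (c.pos i))).map Prod.fst).getD (c.pos i) := by
  rw [← decision_of_running h]; rfl

theorem entry_gatheringNext {P : PortLabeling G} {c : Config V ι RobotState} {i : ι}
    (h : Running (c.state i)) : (gatheringNext P c).entry i =
      ((robotMove G c i).2.bind (P.traverse (c.pos i))).map Prod.snd := by
  rw [← decision_of_running h]; rfl

/-- Where the port `o` leads from `x` (nowhere else if there is none). -/
def PortLabeling.move (P : PortLabeling G) (x : V) (o : Option ℕ) : V :=
  ((o.bind (P.traverse x)).map Prod.fst).getD x

omit [DecidableEq V] in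
@[simp] theorem PortLabeling.move_none (P : PortLabeling G) (x : V) : P.move x none = x := rfl

end Run

/-! ### Finders, helpers and waiters -/

section Roles

variable {V ι : Type*} [Fintype ι] {ident : ι → ℕ} {start : ι → V}

theorem exists_isFinder (ident : ι → ℕ) {start : ι → V} {j : ι} (h : Accompanied start j) :
    ∃ i, IsFinder ident start i ∧ start j = start i := by
  classical
  obtain ⟨k, hk, hkj⟩ := h
  obtain ⟨i, hi, hmin⟩ := Finset.exists_min_image (Finset.univ.filter fun i => start i = start j)
    ident ⟨j, by simp⟩
  have hi : start i = start j := by simpa using hi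
  refine ⟨i, ⟨?_, fun l hl => hmin l (by simp [hl, hi])⟩, hi.symm⟩
  by_cases hij : i = j
  · subst hij; exact ⟨k, hk, hkj⟩
  · exact ⟨j, Ne.symm hij, hi.symm⟩

theorem role_cases (ident : ι → ℕ) (start : ι → V) (j : ι) : IsFinder ident start j ∨
    (∃ i, IsFinder ident start i ∧ j ≠ i ∧ start j = start i) ∨ ¬ Accompanied start j := by
  by_cases h : Accompanied start j
  · obtain ⟨i, hi, hij⟩ := exists_isFinder ident h
    by_cases hji : j = i
    · subst hji; exact Or.inl hi
    · exact Or.inr (Or.inl ⟨i, hi, hji, hij⟩)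
  · exact Or.inr (Or.inr h)

end Roles

/-! ### The first phase -/

section PhaseOne

variable {V ι : Type*} [Fintype V] [DecidableEq V] [Fintype ι]
  {G : SimpleGraph V} [DecidableRel G.Adj]

/-- The survey is unused, or it belongs to a partial map of the graph and its numbers are small. -/
def SurveyFits (P : PortLabeling G) (s : Survey) : Prop :=
  s = Survey.fresh [] ∨ ∃ r φ, PartialMap P r s.map φ ∧ s.pc ≤ 6 * Fintype.card V ∧
    s.q ≤ Fintype.card V ∧ s.d ≤ Fintype.card V ∧ ∀ w, s.hit = some w → w ≤ Fintype.card V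

/-- Finder `i` in the configuration `c`, with its token at `y`, as a finder that is alone with its
token. -/
def soloView (G : SimpleGraph V) [DecidableRel G.Adj] (c : Config V ι RobotState) (i : ι) (y : V) :
    SoloState V :=
  ⟨(c.state i).survey.update (G.degree (c.pos i)) (c.entry i) (decide (c.pos i = y)), c.pos i, y⟩

/-- The configuration after `t + 1` rounds, when these belong to the first phase. -/
structure PhaseOneInv (P : PortLabeling G) (ident : ι → ℕ) (start : ι → V) (t : ℕ)
    (c : Config V ι RobotState) : Prop where
  n_eq : ∀ i, (c.state i).n = Fintype.card V
  ident_eq : ∀ i, (c.state i).ident = ident i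
  clock_eq : ∀ i, (c.state i).clock = t + 1
  follows_eq : ∀ i, (c.state i).follows = false
  fits : ∀ i, SurveyFits P (c.state i).survey
  finder : ∀ i, IsFinder ident start i → (c.state i).role = .finder ∧ (c.state i).gid = ident i
  helper : ∀ i j, IsFinder ident start i → j ≠ i → start j = start i →
    (c.state j).role = .helper ∧ (c.state j).gid = ident i
  waiter : ∀ i, ¬ Accompanied start i →
    (c.state i).role = .waiter ∧ (c.state i).gid = 0 ∧ c.pos i = start i
  explore : ∀ i, IsFinder ident start i →
    ∃ y, (∀ j, j ≠ i → start j = start i → c.pos j = y) ∧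
      Progress P (start i) (soloView G c i y) t

namespace PhaseOneInv

variable {P : PortLabeling G} {ident : ι → ℕ} {start : ι → V} {t : ℕ} {c : Config V ι RobotState}

theorem isFinder_of_role (h : PhaseOneInv P ident start t c) {i : ι}
    (hr : (c.state i).role = .finder) : IsFinder ident start i := by
  rcases role_cases ident start i with hi | ⟨k, hk, hik, hs⟩ | hi
  · exact hi
  · rw [(h.helper k i hk hik hs).1] at hr; cases hr
  · rw [(h.waiter i hi).1] at hr; cases hr

theorem helper_of_role (h : PhaseOneInv P ident start t c) (hid : Function.Injective ident)
    {i j : ι} (hr : (c.state j).role = .helper) (hg : (c.state j).gid = ident i) :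
    j ≠ i ∧ start j = start i := by
  rcases role_cases ident start j with hj | ⟨k, hk, hjk, hs⟩ | hj
  · rw [(h.finder j hj).1] at hr; cases hr
  · have := (h.helper k j hk hjk hs).2
    rw [hg] at this
    cases hid this
    exact ⟨hjk, hs⟩
  · rw [(h.waiter j hj).1] at hr; cases hr

omit [Fintype ι] in
theorem running (h : PhaseOneInv P ident start t c) (ht : t + 1 < phaseOneLength (Fintype.card V))
    (i : ι) : Running (c.state i) := by
  unfold Running
  rw [h.clock_eq, h.n_eq]
  omega

theorem robotMove_eq (h : PhaseOneInv P ident start t c)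
    (ht : t + 1 < phaseOneLength (Fintype.card V)) (i : ι) :
    robotMove G c i =
      ({ (phaseOne (c.state i, c.entry i) (G.degree (c.pos i)) (c.messages (c.pos i))).1 with
          clock := t + 2 },
        (phaseOne (c.state i, c.entry i) (G.degree (c.pos i)) (c.messages (c.pos i))).2) := by
  rw [robotMove, robotAct]
  simp only [h.clock_eq, h.n_eq, if_neg (Nat.succ_ne_zero t), if_pos ht]

theorem tokenPresent_eq (h : PhaseOneInv P ident start t c) (hid : Function.Injective ident)
    {i : ι} (hi : IsFinder ident start i) {y : V}
    (hy : ∀ j, j ≠ i → start j = start i → c.pos j = y) :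
    tokenPresent (c.state i) (c.messages (c.pos i)) = decide (c.pos i = y) := by
  unfold tokenPresent
  rw [decide_eq_decide, Multiset.card_pos_iff_exists_mem]
  simp only [Multiset.mem_filter, Config.mem_messages, h.ident_eq]
  constructor
  · rintro ⟨_, ⟨j, hj, rfl⟩, hr, hg⟩
    obtain ⟨h1, h2⟩ := h.helper_of_role hid hr hg
    rw [← hj, hy j h1 h2]
  · intro hp
    obtain ⟨j, hji, hs⟩ := hi.1
    exact ⟨_, ⟨j, by rw [hp, hy j hji hs], rfl⟩, h.helper i j hi hji hs⟩

theorem currentSurvey_eq (h : PhaseOneInv P ident start t c) (hid : Function.Injective ident)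
    {i : ι} (hi : IsFinder ident start i) {y : V}
    (hy : ∀ j, j ≠ i → start j = start i → c.pos j = y) :
    currentSurvey (c.state i, c.entry i) (G.degree (c.pos i)) (c.messages (c.pos i)) =
      (soloView G c i y).survey := by
  unfold currentSurvey
  simp only [h.tokenPresent_eq hid hi hy]
  rfl

theorem robotMove_finder (h : PhaseOneInv P ident start t c) (hid : Function.Injective ident)
    (ht : t + 1 < phaseOneLength (Fintype.card V)) {i : ι} (hi : IsFinder ident start i) {y : V}
    (hy : ∀ j, j ≠ i → start j = start i → c.pos j = y) :
    robotMove G c i =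
      ({ c.state i with survey := (soloView G c i y).survey.advance, clock := t + 2 },
        (soloView G c i y).survey.nextMove.map Move.port) := by
  rw [h.robotMove_eq ht, phaseOne]
  simp only [(h.finder i hi).1, h.currentSurvey_eq hid hi hy]

/-- The helpers of a group act as its token: they move exactly if the finder is with them and takes
the token along. -/
theorem robotMove_helper (h : PhaseOneInv P ident start t c) (hid : Function.Injective ident)
    (ht : t + 1 < phaseOneLength (Fintype.card V)) {i : ι} (hi : IsFinder ident start i) {y : V}
    (hy : ∀ j, j ≠ i → start j = start i → c.pos j = y) {j : ι} (hji : j ≠ i)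
    (hs : start j = start i) :
    robotMove G c j = ({ c.state j with clock := t + 2 },
      if c.pos i = y then
        (soloView G c i y).survey.nextMove.bind fun m => if m.carry then some m.port else none
      else none) := by
  obtain ⟨hr, hg⟩ := h.helper i j hi hji hs
  rw [h.robotMove_eq ht, phaseOne]
  simp only [hr, hg]
  refine Prod.ext rfl ?_
  change carryPort _ _ _ = _
  unfold carryPort
  split
  · next hp =>
    have hpj : c.pos j = c.pos i := by rw [hp, hy j hji hs]
    have hd : G.degree (c.pos j) = G.degree (c.pos i) := congrArg (fun z => G.degree z) hpj
    rw [hd, hpj]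
    classical
    have hF : ∀ k, (if (c.state k).role = Role.finder ∧ (c.state k).ident = ident i then
        (currentSurvey (c.state k, c.entry k) (G.degree (c.pos i))
          (c.messages (c.pos i))).nextMove.bind
            fun m => if m.carry = true then some m.port else none
        else none) = if k = i then (soloView G c i y).survey.nextMove.bind
          fun m => if m.carry = true then some m.port else none else none := by
      intro k
      by_cases hk : k = i
      · subst hk
        rw [if_pos ⟨(h.finder k hi).1, h.ident_eq k⟩, if_pos rfl, h.currentSurvey_eq hid hi hy]
      · rw [if_neg hk, if_neg]
        rintro ⟨-, h2⟩
        exact hk (hid ((h.ident_eq k).symm.trans h2))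
    apply least_filterMap
    · intro x hx
      obtain ⟨k, -, rfl⟩ := Config.mem_messages.1 hx
      have := hF k
      simp only at this ⊢
      rw [this]
      split
      · exact Or.inr rfl
      · exact Or.inl rfl
    · refine ⟨_, Config.mem_messages.2 ⟨i, rfl, rfl⟩, ?_⟩
      have := hF i
      rw [if_pos rfl] at this
      exact this
  · next hp =>
    rw [least_eq_none_iff]
    intro x hx
    obtain ⟨_, hm, he⟩ := (Multiset.mem_filterMap _ _).1 hx
    obtain ⟨k, hk, rfl⟩ := Config.mem_messages.1 hm
    split at he
    · next hk' =>
      have : k = i := hid ((h.ident_eq k).symm.trans hk'.2)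
      subst this
      exact hp (hk.trans (hy j hji hs))
    · cases he

theorem robotMove_waiter (h : PhaseOneInv P ident start t c)
    (ht : t + 1 < phaseOneLength (Fintype.card V)) {i : ι} (hi : ¬ Accompanied start i) :
    robotMove G c i = ({ c.state i with clock := t + 2 }, none) := by
  rw [h.robotMove_eq ht, phaseOne]
  simp only [(h.waiter i hi).1]

/-- A round of the first phase is a solo round for each finder with its token. -/
theorem soloView_next (h : PhaseOneInv P ident start t c) (hid : Function.Injective ident)
    (ht : t + 1 < phaseOneLength (Fintype.card V)) {i : ι} (hi : IsFinder ident start i) {y : V}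
    (hy : ∀ j, j ≠ i → start j = start i → c.pos j = y) :
    (∀ j, j ≠ i → start j = start i →
      (gatheringNext P c).pos j = (soloStep P (soloView G c i y)).token) ∧
    soloView G (gatheringNext P c) i (soloStep P (soloView G c i y)).token =
      soloStep P (soloView G c i y) := by
  have hrun := h.running ht
  constructor
  · intro j hji hs
    rw [pos_gatheringNext (hrun j), h.robotMove_helper hid ht hi hy hji hs, hy j hji hs]
    simp only [soloStep]
    change _ = if c.pos i = y then _ else y
    split
    · next hp => rw [← hp]; rfl
    · rfl
  · have hpos : (gatheringNext P c).pos i = (soloStep P (soloView G c i y)).pos := by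
      rw [pos_gatheringNext (hrun i), h.robotMove_finder hid ht hi hy]
      rfl
    have hd : G.degree ((gatheringNext P c).pos i) =
      G.degree (soloStep P (soloView G c i y)).pos := congrArg (fun z => G.degree z) hpos
    rw [soloView, hd, hpos, entry_gatheringNext (hrun i), state_gatheringNext (hrun i),
      h.robotMove_finder hid ht hi hy]
    exact (soloStep_eq P _).symm

theorem next (h : PhaseOneInv P ident start t c) (hid : Function.Injective ident)
    (ht : t + 1 < phaseOneLength (Fintype.card V)) :
    PhaseOneInv P ident start (t + 1) (gatheringNext P c) := by
  have hrun := h.running ht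
  have hstate : ∀ i, ∃ s, (gatheringNext P c).state i =
      { c.state i with survey := s, clock := t + 2 } ∧ SurveyFits P s := by
    intro i
    rw [state_gatheringNext (hrun i)]
    rcases role_cases ident start i with hi | ⟨k, hk, hik, hs⟩ | hi
    · obtain ⟨y, hy, hp⟩ := h.explore i hi
      rw [h.robotMove_finder hid ht hi hy]
      refine ⟨_, rfl, Or.inr ⟨start i, ?_⟩⟩
      obtain ⟨φ, h1, h2, h3, h4, h5⟩ := hp.exists_partialMap
      refine ⟨φ, ?_⟩
      unfold Survey.advance
      split
      · exact ⟨h1, h2.le, h3, h4, h5⟩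
      · exact ⟨h1, h2, h3, h4, h5⟩
    · obtain ⟨y, hy, -⟩ := h.explore k hk
      rw [h.robotMove_helper hid ht hk hy hik hs]
      exact ⟨_, rfl, h.fits i⟩
    · rw [h.robotMove_waiter ht hi]
      exact ⟨_, rfl, h.fits i⟩
  refine ⟨fun i => ?_, fun i => ?_, fun i => ?_, fun i => ?_, fun i => ?_, fun i hi => ?_,
    fun i j hi hji hs => ?_, fun i hi => ?_, fun i hi => ?_⟩
  · obtain ⟨s, e, hs⟩ := hstate i
    rw [e]; exact h.n_eq i
  · obtain ⟨s, e, hs⟩ := hstate i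
    rw [e]; exact h.ident_eq i
  · obtain ⟨s, e, hs⟩ := hstate i
    rw [e]
  · obtain ⟨s, e, hs⟩ := hstate i
    rw [e]; exact h.follows_eq i
  · obtain ⟨s, e, hs⟩ := hstate i
    rw [e]; exact hs
  · obtain ⟨s, e, hs⟩ := hstate i
    rw [e]; exact h.finder i hi
  · obtain ⟨s, e, -⟩ := hstate j
    rw [e]; exact h.helper i j hi hji hs
  · obtain ⟨s, e, hs⟩ := hstate i
    rw [e, pos_gatheringNext (hrun i), h.robotMove_waiter ht hi]
    exact h.waiter i hi
  · obtain ⟨y, hy, hp⟩ := h.explore i hi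
    obtain ⟨h1, h2⟩ := h.soloView_next hid ht hi hy
    refine ⟨_, h1, ?_⟩
    rw [h2]
    exact hp.soloStep

/-- At the end of the first phase the maps are complete. -/
theorem next_complete (h : PhaseOneInv P ident start t c) (hid : Function.Injective ident)
    (ht : t + 2 = phaseOneLength (Fintype.card V)) {i : ι} (hi : IsFinder ident start i) :
    ∃ M φ, ((gatheringNext P c).state i).survey = Survey.fresh M ∧ PartialMap P (start i) M φ ∧
      M.openPorts = [] ∧ (gatheringNext P c).pos i = start i ∧
      ∀ j, j ≠ i → start j = start i → (gatheringNext P c).pos j = start i := by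
  have ht' : t + 1 < phaseOneLength (Fintype.card V) := by omega
  obtain ⟨y, hy, hp⟩ := h.explore i hi
  have hc := hp.complete ht.ge
  obtain ⟨h1, h2⟩ := h.soloView_next hid ht' hi hy
  rw [hc.soloStep] at h1 h2
  have hs : ((gatheringNext P c).state i).survey = (soloView G c i y).survey.advance := by
    rw [state_gatheringNext (h.running ht' i), h.robotMove_finder hid ht' hi hy]
  have hpos : (gatheringNext P c).pos i = (soloView G c i y).pos := congrArg SoloState.pos h2
  obtain ⟨M, φ, hM, ho, e⟩ := hc
  rw [e] at hs hpos h1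
  refine ⟨M, φ, ?_, hM, ho, hpos, h1⟩
  rw [hs]
  have hw : (Survey.fresh M).walk = [] := Survey.walk_eq_nil ho
  simp [Survey.advance, Survey.nextMove, hw]

end PhaseOneInv

/-- The first round, in which the roles are determined. -/
theorem phaseOneInv_one [Nonempty V] (P : PortLabeling G) {ident : ι → ℕ}
    (hid : Function.Injective ident) (start : ι → V) :
    PhaseOneInv P ident start 0 (gatheringRun P ident start 1) := by
  have hn : 0 < Fintype.card V := Fintype.card_pos
  set c := gatheringRun P ident start 0 with hc
  have hstate0 : ∀ i, c.state i = ⟨Fintype.card V, ident i, 0, .undecided, 0, false,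
    ⟨[], 0, 0, 0, none⟩⟩ := fun i => rfl
  have hrun : ∀ i, Running (c.state i) := fun i => by
    unfold Running
    rw [hstate0]
    simp only
    omega
  have hmove : ∀ i, robotMove G c i = ({ assignRole (c.state i) (G.degree (start i))
      (c.messages (start i)) with clock := 1 }, none) := fun i => rfl
  have hstate : ∀ i, (gatheringRun P ident start 1).state i =
      { assignRole (c.state i) (G.degree (start i)) (c.messages (start i)) with clock := 1 } :=
    fun i => by rw [gatheringRun_succ, state_gatheringNext (hrun i), hmove]
  have hpos : ∀ i, (gatheringRun P ident start 1).pos i = start i :=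
    fun i => by rw [gatheringRun_succ, pos_gatheringNext (hrun i), hmove]; rfl
  have hcard : ∀ i, (c.messages (start i)).card ≤ 1 ↔ ¬ Accompanied start i := by
    intro i
    rw [Config.card_messages, Finset.card_le_one_iff]
    constructor
    · rintro h ⟨j, hji, hs⟩
      exact hji (h (Finset.mem_filter.2 ⟨Finset.mem_univ _, hs⟩)
        (Finset.mem_filter.2 ⟨Finset.mem_univ _, rfl⟩))
    · intro h a b ha hb
      have : ∀ a, a ∈ Finset.univ.filter (fun j => c.pos j = start i) → a = i := by
        intro a ha
        by_contra hai
        exact h ⟨a, hai, (Finset.mem_filter.1 ha).2⟩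
      rw [this a ha, this b hb]
  have hleast : ∀ i j, IsFinder ident start i → start j = start i →
      least ((c.messages (start j)).map fun x => x.1.ident) = some (ident i) := by
    intro i j hi hs
    rw [least_eq_some_iff]
    constructor
    · exact Multiset.mem_map.2 ⟨_, Config.mem_messages.2 ⟨i, hs.symm, rfl⟩, rfl⟩
    · intro x hx
      obtain ⟨_, hm, rfl⟩ := Multiset.mem_map.1 hx
      obtain ⟨k, hk, rfl⟩ := Config.mem_messages.1 hm
      exact hi.2 k (hk.trans hs)
  have hfinder : ∀ i, IsFinder ident start i → (gatheringRun P ident start 1).state i =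
      ⟨Fintype.card V, ident i, 1, .finder, ident i, false, Survey.start (G.degree (start i))⟩ := by
    intro i hi
    rw [hstate, assignRole, if_neg (fun h => (hcard i).1 h hi.1), hleast i i hi rfl]
    simp [hstate0]
  have hhelper : ∀ i j, IsFinder ident start i → j ≠ i → start j = start i →
      (gatheringRun P ident start 1).state j =
      ⟨Fintype.card V, ident j, 1, .helper, ident i, false, Survey.fresh []⟩ := by
    intro i j hi hji hs
    rw [hstate, assignRole, if_neg (fun h => (hcard j).1 h ⟨i, hji.symm, hs.symm⟩),
      hleast i j hi hs]
    have : ident j ≠ ident i := fun h => hji (hid h)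
    simp [hstate0, this, Survey.fresh]
  have hwaiter : ∀ i, ¬ Accompanied start i → (gatheringRun P ident start 1).state i =
      ⟨Fintype.card V, ident i, 1, .waiter, 0, false, Survey.fresh []⟩ := by
    intro i hi
    rw [hstate, assignRole, if_pos ((hcard i).2 hi)]
    simp [hstate0, Survey.fresh]
  have hmap : ∀ r : V, PartialMap P r (Survey.start (G.degree r)).map fun _ => r :=
    fun r => PartialMap.singleton P r
  have hall : ∀ i, ∃ ro g s, (gatheringRun P ident start 1).state i =
      ⟨Fintype.card V, ident i, 1, ro, g, false, s⟩ ∧ SurveyFits P s := by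
    intro i
    rcases role_cases ident start i with hi | ⟨k, hk, hik, hs⟩ | hi
    · refine ⟨_, _, _, hfinder i hi, Or.inr ⟨start i, _, hmap _, ?_⟩⟩
      simp [Survey.start]
    · exact ⟨_, _, _, hhelper k i hk hik hs, Or.inl rfl⟩
    · exact ⟨_, _, _, hwaiter i hi, Or.inl rfl⟩
  refine ⟨fun i => ?_, fun i => ?_, fun i => ?_, fun i => ?_, fun i => ?_, fun i hi => ?_,
    fun i j hi hji hs => ?_, fun i hi => ?_, fun i hi => ?_⟩
  · obtain ⟨_, _, _, e, -⟩ := hall i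
    rw [e]
  · obtain ⟨_, _, _, e, -⟩ := hall i
    rw [e]
  · obtain ⟨_, _, _, e, -⟩ := hall i
    rw [e]
  · obtain ⟨_, _, _, e, -⟩ := hall i
    rw [e]
  · obtain ⟨_, _, _, e, hs⟩ := hall i
    rw [e]; exact hs
  · rw [hfinder i hi]; exact ⟨rfl, rfl⟩
  · rw [hhelper i j hi hji hs]; exact ⟨rfl, rfl⟩
  · rw [hwaiter i hi]; exact ⟨rfl, rfl, hpos i⟩
  · refine ⟨start i, fun j _ hs => (hpos j).trans hs, ?_⟩
    have : soloView G (gatheringRun P ident start 1) i (start i) =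
        ⟨Survey.fresh (Survey.start (G.degree (start i))).map, start i, start i⟩ := by
      unfold soloView
      rw [hfinder i hi]
      change SoloState.mk (Survey.update (Survey.fresh _) _ _ _) _ _ = _
      rw [Survey.update_fresh, hpos]
      rfl
    rw [this]
    exact Progress.fresh (hmap _) (Nat.zero_le _)

theorem phaseOneInv_run [Nonempty V] (P : PortLabeling G) {ident : ι → ℕ}
    (hid : Function.Injective ident) (start : ι → V) {t : ℕ}
    (ht : t + 1 ≤ phaseOneLength (Fintype.card V)) :
    PhaseOneInv P ident start t (gatheringRun P ident start (t + 1)) := by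
  induction t with
  | zero => exact phaseOneInv_one P hid start
  | succ t ih => exact (ih (by omega)).next hid (by omega)

end PhaseOne

/-! ### The tour of a complete map -/

section Tour

variable {V : Type*} [Fintype V] {G : SimpleGraph V} [DecidableRel G.Adj]

/-- The position after `k` moves along the ports of `l`, starting at `r`; it does not change after
the end of the list. -/
def posAlong (P : PortLabeling G) (r : V) (l : List (ℕ × ℕ)) : ℕ → V
  | 0 => r
  | k + 1 => P.move (posAlong P r l k) (l[k]?.map Prod.fst)

theorem IsTour.drop {P : PortLabeling G} {φ : ℕ → V} {r y : V} {l : List (ℕ × ℕ)}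
    (h : IsTour P φ r l y) (k : ℕ) : IsTour P φ (posAlong P r l k) (l.drop k) y := by
  induction k with
  | zero => exact h
  | succ k ih =>
    by_cases hk : k < l.length
    · rw [List.drop_eq_getElem_cons hk] at ih
      obtain ⟨⟨q, h1⟩, h2⟩ := ih
      simp only [List.get_eq_getElem] at h1
      have : posAlong P r l (k + 1) = φ l[k].2 := by
        simp [posAlong, PortLabeling.move, hk, h1]
      rw [this]
      exact h2
    · have hk := not_lt.1 hk
      rw [List.drop_eq_nil_of_le hk] at ih
      rw [List.drop_eq_nil_of_le (hk.trans (Nat.le_succ k))]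
      simpa [posAlong, List.getElem?_eq_none hk] using ih

theorem IsTour.posAlong_succ {P : PortLabeling G} {φ : ℕ → V} {r y : V} {l : List (ℕ × ℕ)}
    (h : IsTour P φ r l y) {k : ℕ} (hk : k < l.length) :
    posAlong P r l (k + 1) = φ l[k].2 := by
  have ih := h.drop k
  rw [List.drop_eq_getElem_cons hk] at ih
  obtain ⟨⟨q, h1⟩, -⟩ := ih
  simp only [List.get_eq_getElem] at h1
  simp [posAlong, PortLabeling.move, hk, h1]

theorem IsTour.posAlong_of_length_le {P : PortLabeling G} {φ : ℕ → V} {r y : V}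
    {l : List (ℕ × ℕ)} (h : IsTour P φ r l y) {k : ℕ} (hk : l.length ≤ k) :
    posAlong P r l k = y := by
  have ih := h.drop k
  rwa [List.drop_eq_nil_of_le hk] at ih

namespace PartialMap

variable {P : PortLabeling G} {r : V} {M : GraphMap} {φ : ℕ → V}

theorem length_tour_lt (h : PartialMap P r M φ) : M.tour.length + 2 ≤ 2 * Fintype.card V := by
  have h1 := h.length_tour_le
  have h2 := h.length_le
  have h3 := h.length_pos
  omega

/-- The tour of a complete map visits the whole graph. -/
theorem exists_posAlong_eq (h : PartialMap P r M φ) (ho : M.openPorts = []) (hG : G.Connected)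
    (x : V) : ∃ k < 2 * Fintype.card V, posAlong P r M.tour k = x := by
  obtain ⟨v, hv, rfl⟩ := h.surjective_of_openPorts_eq_nil ho hG x
  have hlt := h.length_tour_lt
  by_cases hl : 1 < M.length
  · obtain ⟨a, ha, rfl⟩ := List.mem_map.1 (h.mem_tour hl hv)
    obtain ⟨k, hk, rfl⟩ := List.getElem_of_mem ha
    exact ⟨k + 1, by omega, h.isTour_tour.posAlong_succ hk⟩
  · obtain rfl : v = 0 := by omega
    exact ⟨0, by omega, h.root.symm⟩

theorem posAlong_end (h : PartialMap P r M φ) :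
    posAlong P r M.tour (2 * Fintype.card V) = r :=
  h.isTour_tour.posAlong_of_length_le (by have := h.length_tour_lt; omega)

end PartialMap

end Tour

/-! ### The second phase -/

section PhaseTwo

variable {V ι : Type*} [Fintype V] [DecidableEq V] [Fintype ι]
  {G : SimpleGraph V} [DecidableRel G.Adj]

/-- The robots at the node of robot `i`, as they present themselves. -/
abbrev peersOf (c : Config V ι RobotState) (i : ι) : Peers := c.messages (c.pos i)

omit [Fintype V] in
theorem leastGroup_eq_some_iff {c : Config V ι RobotState} {v : V} {g : ℕ} :
    leastGroup (c.messages v) = some g ↔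
      (∃ j, c.pos j = v ∧ ((c.state j).role = .finder ∨ (c.state j).role = .helper) ∧
        (c.state j).gid = g) ∧
      ∀ j, c.pos j = v → ((c.state j).role = .finder ∨ (c.state j).role = .helper) →
        g ≤ (c.state j).gid := by
  unfold leastGroup
  rw [least_eq_some_iff]
  simp only [Multiset.mem_filterMap, Config.mem_messages, Option.ite_none_right_eq_some,
    Option.some.injEq]
  refine and_congr ⟨?_, ?_⟩ ⟨?_, ?_⟩
  · rintro ⟨_, ⟨j, hj, rfl⟩, hr, hg⟩
    exact ⟨j, hj, hr, hg⟩
  · rintro ⟨j, hj, hr, hg⟩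
    exact ⟨_, ⟨j, hj, rfl⟩, hr, hg⟩
  · intro h j hj hr
    exact h _ ⟨_, ⟨j, hj, rfl⟩, hr, rfl⟩
  · rintro h _ ⟨_, ⟨j, hj, rfl⟩, hr, rfl⟩
    exact h j hj hr

omit [Fintype V] in
theorem leastFinder_eq_some_iff {c : Config V ι RobotState} {v : V} {g : ℕ} :
    leastFinder (c.messages v) = some g ↔
      (∃ j, c.pos j = v ∧ (c.state j).role = .finder ∧ (c.state j).gid = g) ∧
      ∀ j, c.pos j = v → (c.state j).role = .finder → g ≤ (c.state j).gid := by
  unfold leastFinder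
  rw [least_eq_some_iff]
  simp only [Multiset.mem_filterMap, Config.mem_messages, Option.ite_none_right_eq_some,
    Option.some.injEq]
  refine and_congr ⟨?_, ?_⟩ ⟨?_, ?_⟩
  · rintro ⟨_, ⟨j, hj, rfl⟩, hr, hg⟩
    exact ⟨j, hj, hr, hg⟩
  · rintro ⟨j, hj, hr, hg⟩
    exact ⟨_, ⟨j, hj, rfl⟩, hr, hg⟩
  · intro h j hj hr
    exact h _ ⟨_, ⟨j, hj, rfl⟩, hr, rfl⟩
  · rintro h _ ⟨_, ⟨j, hj, rfl⟩, hr, rfl⟩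
    exact h j hj hr

omit [Fintype V] in
theorem exists_leastGroup {c : Config V ι RobotState} {i : ι}
    (h : (c.state i).role = .finder ∨ (c.state i).role = .helper) :
    ∃ g, leastGroup (peersOf c i) = some g := by
  rcases hg : leastGroup (peersOf c i) with _ | g
  · unfold leastGroup at hg
    rw [least_eq_none_iff] at hg
    refine absurd ((Multiset.mem_filterMap _ _).2
      ⟨_, Config.mem_messages.2 ⟨i, rfl, rfl⟩, if_pos h⟩) (hg (c.state i).gid)
  · exact ⟨g, rfl⟩

/-- The possible actions of robot `i` in a round of the second phase: new memory (up to the clock)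
and chosen port. -/
inductive Outcome (c : Config V ι RobotState) (i : ι) : RobotState → Option ℕ → Prop
  /-- A finder whose group identifier is the least one present continues its walk. -/
  | lead : (c.state i).role = .finder → leastGroup (peersOf c i) = some (c.state i).gid →
      Outcome c i (c.state i) (tourPort (c.state i))
  /-- A robot joins the group of the finder of least group identifier and follows it. -/
  | follow (g : ℕ) : leastFinder (peersOf c i) = some g →
      ((c.state i).role = .finder → leastGroup (peersOf c i) ≠ some (c.state i).gid) →
      ((c.state i).role = .helper → g < (c.state i).gid) →
      Outcome c i { c.state i with role := .helper, gid := g, follows := true }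
        (leaderPort g (peersOf c i))
  /-- A finder that meets helpers of a smaller group, but not the finder of this group, joins this
  group and stays. -/
  | settle (g : ℕ) : (c.state i).role = .finder → leastGroup (peersOf c i) = some g →
      g ≠ (c.state i).gid → leastFinder (peersOf c i) ≠ some g →
      Outcome c i { c.state i with role := .helper, gid := g, follows := false } none
  /-- A helper that does not meet a finder of a smaller group acts as before. -/
  | keep : (c.state i).role = .helper →
      (∀ g, leastFinder (peersOf c i) = some g → (c.state i).gid ≤ g) →
      Outcome c i (c.state i)
        (if (c.state i).follows then leaderPort (c.state i).gid (peersOf c i) else none)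
  /-- A waiter that meets no finder waits. -/
  | wait : (c.state i).role = .waiter → leastFinder (peersOf c i) = none →
      Outcome c i (c.state i) none

omit [Fintype V] in
theorem outcome_phaseTwo (c : Config V ι RobotState) (i : ι)
    (h : (c.state i).role ≠ .undecided) :
    Outcome c i (phaseTwo (c.state i) (peersOf c i)).1 (phaseTwo (c.state i) (peersOf c i)).2 := by
  unfold phaseTwo
  rcases hr : (c.state i).role
  · exact absurd hr h
  · obtain ⟨g, hg⟩ := exists_leastGroup (c := c) (i := i) (Or.inl hr)
    simp only [hg, Option.getD_some]
    by_cases h1 : g = (c.state i).gid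
    · rw [if_pos h1]
      exact Outcome.lead hr (h1 ▸ hg)
    · rw [if_neg h1]
      by_cases h2 : leastFinder (peersOf c i) = some g
      · rw [if_pos h2]
        exact Outcome.follow g h2 (fun _ h3 => h1 (Option.some.inj (hg.symm.trans h3)))
          (fun h3 => by rw [hr] at h3; cases h3)
      · rw [if_neg h2]
        exact Outcome.settle g hr hg h1 h2
  · rcases hf : leastFinder (peersOf c i) with _ | g
    · simp only
      exact Outcome.keep hr (fun g hg => by rw [hf] at hg; cases hg)
    · simp only
      by_cases h1 : g < (c.state i).gid
      · simp only [if_pos h1, if_true]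
        rw [← hr]
        have := Outcome.follow (c := c) (i := i) g hf
          (fun h3 => by rw [hr] at h3; cases h3) (fun _ => h1)
        rwa [← hr] at this
      · simp only [if_neg h1]
        refine Outcome.keep hr (fun g' hg => ?_)
        rw [hf] at hg
        cases hg
        exact not_lt.1 h1
  · rcases hf : leastFinder (peersOf c i) with _ | g
    · exact Outcome.wait hr hf
    · exact Outcome.follow g hf (fun h3 => by rw [hr] at h3; cases h3)
        (fun h3 => by rw [hr] at h3; cases h3)

/-- Robot `i` is a finder, or it follows one. -/
def WithFinder (ident : ι → ℕ) (c : Config V ι RobotState) (i : ι) : Prop :=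
  (c.state i).role = .finder ∨
    ((c.state i).role = .helper ∧ (c.state i).follows = true ∧
      ∃ j, (c.state j).role = .finder ∧ (c.state i).gid = ident j ∧ c.pos i = c.pos j)

/-- The configuration after `k` rounds of the second phase; `M i` is the map of the finder `i`, and
`f` is the finder of least identifier. -/
structure PhaseTwoInv (P : PortLabeling G) (ident : ι → ℕ) (start : ι → V) (M : ι → GraphMap)
    (f : ι) (k : ℕ) (c : Config V ι RobotState) : Prop where
  n_eq : ∀ i, (c.state i).n = Fintype.card V
  ident_eq : ∀ i, (c.state i).ident = ident i
  clock_eq : ∀ i, (c.state i).clock = phaseOneLength (Fintype.card V) + k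
  fits : ∀ i, SurveyFits P (c.state i).survey
  gid_mem : ∀ i, (c.state i).gid = 0 ∨ ∃ j, (c.state i).gid = ident j
  decided : ∀ i, (c.state i).role ≠ .undecided
  isFinder : ∀ i, (c.state i).role = .finder → IsFinder ident start i
  finder : ∀ i, (c.state i).role = .finder → (c.state i).gid = ident i ∧
    (c.state i).survey.map = M i ∧ c.pos i = posAlong P (start i) (M i).tour k
  leader : (c.state f).role = .finder
  /-- Some helper of the group of `f` stays at the root. -/
  anchor : ∃ a, (c.state a).role = .helper ∧ (c.state a).gid = ident f ∧
    (c.state a).follows = false ∧ c.pos a = start f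
  least : ∀ i, (c.state i).role = .finder ∨ (c.state i).role = .helper → ident f ≤ (c.state i).gid
  group : ∀ i, (c.state i).role = .helper → (c.state i).gid = ident f →
    ((c.state i).follows = true → c.pos i = c.pos f) ∧
    ((c.state i).follows = false → c.pos i = start f)
  /-- A robot that is neither with `f` nor at the root nor at a node that `f` has not visited yet is
  another finder or follows one. -/
  place : ∀ i, c.pos i = c.pos f ∨
    (c.pos i = start f ∨ ∀ k' < k, posAlong P (start f) (M f).tour k' ≠ c.pos i) ∨
    WithFinder ident c i
  /-- A finder that reaches the root of `f` is a finder no longer. -/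
  absorbed : ∀ i, (c.state i).role = .finder → i ≠ f →
    ∀ k' < k, posAlong P (start i) (M i).tour k' ≠ start f

namespace PhaseTwoInv

variable {P : PortLabeling G} {ident : ι → ℕ} {start : ι → V} {M : ι → GraphMap} {f : ι} {k : ℕ}
  {c : Config V ι RobotState}

omit [DecidableEq V] [Fintype ι] in
theorem running (h : PhaseTwoInv P ident start M f k c) (hk : k < 2 * Fintype.card V) (i : ι) :
    Running (c.state i) := by
  unfold Running
  rw [h.clock_eq, h.n_eq]
  omega

/-- What a robot does in a round of the second phase. -/
theorem exists_outcome (h : PhaseTwoInv P ident start M f k c) (hk : k < 2 * Fintype.card V)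
    (hn : 0 < Fintype.card V) (i : ι) :
    ∃ s o, Outcome c i s o ∧
      (gatheringNext P c).state i =
        { s with clock := phaseOneLength (Fintype.card V) + k + 1 } ∧
      (gatheringNext P c).pos i = P.move (c.pos i) o := by
  refine ⟨_, _, outcome_phaseTwo c i (h.decided i), ?_, ?_⟩
  all_goals
    have hpos : 0 < phaseOneLength (Fintype.card V) := by unfold phaseOneLength; positivity
    have hmove : robotMove G c i = ({ (phaseTwo (c.state i) (peersOf c i)).1 with
        clock := phaseOneLength (Fintype.card V) + k + 1 },
        (phaseTwo (c.state i) (peersOf c i)).2) := by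
      rw [robotMove, robotAct]
      simp only [h.clock_eq, h.n_eq]
      rw [if_neg (by omega), if_neg (by omega)]
  · rw [state_gatheringNext (h.running hk i), hmove]
  · rw [pos_gatheringNext (h.running hk i), hmove]
    rfl

omit [DecidableEq V] [Fintype ι] in
theorem tourPort_eq (h : PhaseTwoInv P ident start M f k c) {i : ι}
    (hi : (c.state i).role = .finder) : P.move (c.pos i) (tourPort (c.state i)) =
      posAlong P (start i) (M i).tour (k + 1) := by
  obtain ⟨-, h2, h3⟩ := h.finder i hi
  unfold tourPort
  rw [h.clock_eq, h.n_eq, h2, h3, Nat.add_sub_cancel_left]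
  rfl

/-- Where a robot goes that follows the finder `j` of the least group identifier at its node. -/
theorem move_leaderPort (h : PhaseTwoInv P ident start M f k c) (hid : Function.Injective ident)
    {i j : ι} (hj : (c.state j).role = .finder) (hij : c.pos i = c.pos j)
    (hg : leastGroup (peersOf c i) = some (ident j)) :
    P.move (c.pos i) (leaderPort (ident j) (peersOf c i)) =
      posAlong P (start j) (M j).tour (k + 1) := by
  rw [← h.tourPort_eq hj, hij]
  congr 1
  unfold leaderPort
  rw [if_pos hg]
  apply least_filterMap
  · intro x hx
    obtain ⟨l, -, rfl⟩ := Config.mem_messages.1 hx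
    simp only
    split
    · next hl =>
      have : l = j := hid ((h.finder l hl.1).1.symm.trans hl.2)
      subst this
      exact Or.inr rfl
    · exact Or.inl rfl
  · exact ⟨_, Config.mem_messages.2 ⟨j, hij.symm, rfl⟩, if_pos ⟨hj, (h.finder j hj).1⟩⟩

/-- A robot that tries to follow a finder stays, or it follows the finder of the least group
identifier at its node. -/
theorem move_leaderPort_cases (h : PhaseTwoInv P ident start M f k c)
    (hid : Function.Injective ident) (i : ι) (g : ℕ) :
    P.move (c.pos i) (leaderPort g (peersOf c i)) = c.pos i ∨
    ∃ j, (c.state j).role = .finder ∧ c.pos i = c.pos j ∧ g = ident j ∧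
      leastGroup (peersOf c i) = some (ident j) ∧
      P.move (c.pos i) (leaderPort g (peersOf c i)) =
        posAlong P (start j) (M j).tour (k + 1) := by
  by_cases hg : leastGroup (peersOf c i) = some g
  · by_cases hj : ∃ j, (c.state j).role = .finder ∧ c.pos i = c.pos j ∧ g = ident j
    · obtain ⟨j, hj, hij, rfl⟩ := hj
      exact Or.inr ⟨j, hj, hij, rfl, hg, h.move_leaderPort hid hj hij hg⟩
    · left
      have : leaderPort g (peersOf c i) = none := by
        unfold leaderPort
        rw [if_pos hg, least_eq_none_iff]
        intro x hx
        obtain ⟨_, hm, he⟩ := (Multiset.mem_filterMap _ _).1 hx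
        obtain ⟨l, hl, rfl⟩ := Config.mem_messages.1 hm
        split at he
        · next hc => exact hj ⟨l, hc.1, hl.symm, hc.2.symm.trans (h.finder l hc.1).1⟩
        · cases he
      rw [this, P.move_none]
  · left
    have : leaderPort g (peersOf c i) = none := by
      unfold leaderPort
      rw [if_neg hg]
    rw [this, P.move_none]

/-- Where `f` is, its group has the least identifier. -/
theorem least_at_leader (h : PhaseTwoInv P ident start M f k c) {i : ι} (hi : c.pos i = c.pos f) :
    leastGroup (peersOf c i) = some (ident f) ∧ leastFinder (peersOf c i) = some (ident f) := by
  have hg := (h.finder f h.leader).1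
  exact ⟨leastGroup_eq_some_iff.2 ⟨⟨f, hi.symm, Or.inl h.leader, hg⟩, fun j _ hj => h.least j hj⟩,
    leastFinder_eq_some_iff.2 ⟨⟨f, hi.symm, h.leader, hg⟩, fun j _ hj => h.least j (Or.inl hj)⟩⟩

theorem pos_eq_leader (h : PhaseTwoInv P ident start M f k c) (hid : Function.Injective ident)
    {i : ι} (hi : leastFinder (peersOf c i) = some (ident f)) : c.pos i = c.pos f := by
  obtain ⟨⟨j, hj, hr, hg⟩, -⟩ := leastFinder_eq_some_iff.1 hi
  have : j = f := hid ((h.finder j hr).1.symm.trans hg)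
  rw [← hj, this]

/-- A finder that has the least group identifier at its node remains a finder. -/
theorem lead_of_leastGroup (h : PhaseTwoInv P ident start M f k c) (hk : k < 2 * Fintype.card V)
    (hn : 0 < Fintype.card V) {i : ι} (hi : (c.state i).role = .finder)
    (hg : leastGroup (peersOf c i) = some (ident i)) :
    ((gatheringNext P c).state i).role = .finder ∧
      (gatheringNext P c).pos i = posAlong P (start i) (M i).tour (k + 1) := by
  obtain ⟨s, o, ho, hs, hp⟩ := h.exists_outcome hk hn i
  have hgid := (h.finder i hi).1
  rw [hs, hp]
  cases ho with
  | lead => exact ⟨hi, h.tourPort_eq hi⟩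
  | follow g _ h2 _ => exact absurd (hgid ▸ hg) (h2 hi)
  | settle g _ h2 h3 _ =>
    rw [hg] at h2
    exact absurd ((Option.some.inj h2).symm.trans hgid.symm) h3
  | keep h1 => rw [hi] at h1; cases h1
  | wait h1 => rw [hi] at h1; cases h1

theorem leader_next (h : PhaseTwoInv P ident start M f k c) (hk : k < 2 * Fintype.card V)
    (hn : 0 < Fintype.card V) : ((gatheringNext P c).state f).role = .finder ∧
      (gatheringNext P c).pos f = posAlong P (start f) (M f).tour (k + 1) :=
  h.lead_of_leastGroup hk hn h.leader (h.least_at_leader rfl).1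

/-- At a node without `f` that `f` has visited, and that is not its root, the finder of the least
group is present. -/
theorem node_cases (h : PhaseTwoInv P ident start M f k c) {i : ι} (hi : c.pos i ≠ c.pos f)
    {g : ℕ} (hg : leastGroup (peersOf c i) = some g) :
    (c.pos i = start f ∨ ∀ k' < k, posAlong P (start f) (M f).tour k' ≠ c.pos i) ∨
      ∃ j, (c.state j).role = .finder ∧ c.pos i = c.pos j ∧ g = ident j := by
  obtain ⟨⟨x, hx, hr, rfl⟩, -⟩ := leastGroup_eq_some_iff.1 hg
  rcases hr with hr | hr
  · exact Or.inr ⟨x, hr, hx.symm, (h.finder x hr).1⟩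
  · rcases h.place x with h1 | h1 | h1 | ⟨-, -, j, hj, hgj, hxj⟩
    · exact absurd (hx.symm.trans h1) hi
    · rw [hx] at h1; exact Or.inl h1
    · rw [hr] at h1; cases h1
    · exact Or.inr ⟨j, hj, hx.symm.trans hxj, hgj⟩

/-- Robots at a node visited by `f` at this moment go on with `f`, or they are at its root. -/
theorem place_next_of_eq (h : PhaseTwoInv P ident start M f k c) (hid : Function.Injective ident)
    (hk : k < 2 * Fintype.card V) (hn : 0 < Fintype.card V) {i : ι} (hi : c.pos i = c.pos f) :
    (gatheringNext P c).pos i = (gatheringNext P c).pos f ∨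
      (gatheringNext P c).pos i = start f := by
  obtain ⟨hg, hf⟩ := h.least_at_leader hi
  have hmove := h.move_leaderPort hid h.leader hi hg
  obtain ⟨s, o, ho, -, hp⟩ := h.exists_outcome hk hn i
  rw [hp, (h.leader_next hk hn).2]
  cases ho with
  | lead h1 h2 =>
    rw [hg, (h.finder i h1).1] at h2
    have : f = i := hid (Option.some.inj h2)
    subst this
    exact Or.inl (h.tourPort_eq h1)
  | follow g h1 =>
    rw [hf] at h1
    cases h1
    exact Or.inl hmove
  | settle g _ h2 _ h4 =>
    rw [hg] at h2
    cases h2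
    exact absurd hf h4
  | keep h1 h2 =>
    have hgid : (c.state i).gid = ident f := le_antisymm (h2 _ hf) (h.least i (Or.inr h1))
    rcases hfo : (c.state i).follows
    · right
      simpa using (h.group i h1 hgid).2 hfo
    · left
      simpa [hgid] using hmove
  | wait _ h2 => rw [hf] at h2; cases h2

/-- A robot that moves is, after the round, a finder or a follower of one. -/
theorem next_cases (h : PhaseTwoInv P ident start M f k c) (hid : Function.Injective ident)
    (hk : k < 2 * Fintype.card V) (hn : 0 < Fintype.card V) (i : ι) :
    (gatheringNext P c).pos i = c.pos i ∨ WithFinder ident (gatheringNext P c) i := by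
  obtain ⟨s, o, ho, hs, hp⟩ := h.exists_outcome hk hn i
  rw [WithFinder, hp, hs]
  have key : ∀ g, P.move (c.pos i) (leaderPort g (peersOf c i)) = c.pos i ∨
      ∃ j, ((gatheringNext P c).state j).role = .finder ∧ g = ident j ∧
        P.move (c.pos i) (leaderPort g (peersOf c i)) = (gatheringNext P c).pos j := by
    intro g
    rcases h.move_leaderPort_cases hid i g with h1 | ⟨j, h1, h2, h3, h4, h5⟩
    · exact Or.inl h1
    · have hgj : leastGroup (peersOf c j) = some (ident j) := by
        unfold peersOf at h4 ⊢
        rwa [← h2]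
      obtain ⟨h6, h7⟩ := h.lead_of_leastGroup hk hn h1 hgj
      exact Or.inr ⟨j, h6, h3, h5.trans h7.symm⟩
  cases ho with
  | lead h1 _ => exact Or.inr (Or.inl h1)
  | follow g _ _ _ =>
    rcases key g with h1 | ⟨j, h1, h2, h3⟩
    · exact Or.inl h1
    · exact Or.inr (Or.inr ⟨rfl, rfl, j, h1, h2, h3⟩)
  | settle => exact Or.inl rfl
  | keep h1 _ =>
    rcases hfo : (c.state i).follows
    · left; simp
    · rw [if_pos rfl]
      rcases key (c.state i).gid with h4 | ⟨j, h4, h5, h6⟩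
      · exact Or.inl h4
      · exact Or.inr (Or.inr ⟨h1, rfl, j, h4, h5, h6⟩)
  | wait => exact Or.inl rfl

/-- Where the finder of the least group is present, finders and followers of finders go on with
it. -/
theorem next_of_leader_present (h : PhaseTwoInv P ident start M f k c)
    (hid : Function.Injective ident) (hk : k < 2 * Fintype.card V) (hn : 0 < Fintype.card V)
    {i j : ι} (hj : (c.state j).role = .finder) (hij : c.pos i = c.pos j)
    (hg : leastGroup (peersOf c i) = some (ident j))
    (hi : (c.state i).role = .finder ∨
      (c.state i).role = .helper ∧ (c.state i).follows = true) :
    WithFinder ident (gatheringNext P c) i := by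
  have hgj : leastGroup (peersOf c j) = some (ident j) := by
    unfold peersOf at hg ⊢
    rwa [← hij]
  obtain ⟨h6, h7⟩ := h.lead_of_leastGroup hk hn hj hgj
  have hmove := (h.move_leaderPort hid hj hij hg).trans h7.symm
  have hf : leastFinder (peersOf c i) = some (ident j) :=
    leastFinder_eq_some_iff.2 ⟨⟨j, hij.symm, hj, (h.finder j hj).1⟩,
      fun l hl hr => (leastGroup_eq_some_iff.1 hg).2 l hl (Or.inl hr)⟩
  obtain ⟨s, o, ho, hs, hp⟩ := h.exists_outcome hk hn i
  rw [WithFinder, hp, hs]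
  cases ho with
  | lead h1 _ => exact Or.inl h1
  | follow g h1 _ _ =>
    rw [hf] at h1
    cases h1
    exact Or.inr ⟨rfl, rfl, j, h6, rfl, hmove⟩
  | settle g _ h2 _ h4 =>
    rw [hg] at h2
    cases h2
    exact absurd hf h4
  | keep h1 h2 =>
    have hgid : (c.state i).gid = ident j :=
      le_antisymm (h2 _ hf) ((leastGroup_eq_some_iff.1 hg).2 i rfl (Or.inr h1))
    rcases hi with hi | ⟨-, hfo⟩
    · rw [hi] at h1; cases h1
    · refine Or.inr ⟨h1, hfo, j, h6, hgid, ?_⟩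
      simpa [hfo, hgid] using hmove
  | wait h1 =>
    rcases hi with hi | ⟨hi, -⟩ <;> rw [hi] at h1 <;> cases h1

theorem place_next (h : PhaseTwoInv P ident start M f k c) (hid : Function.Injective ident)
    (hk : k < 2 * Fintype.card V) (hn : 0 < Fintype.card V) (i : ι) :
    (gatheringNext P c).pos i = (gatheringNext P c).pos f ∨
    ((gatheringNext P c).pos i = start f ∨
      ∀ k' < k + 1, posAlong P (start f) (M f).tour k' ≠ (gatheringNext P c).pos i) ∨
    WithFinder ident (gatheringNext P c) i := by
  by_cases hi : c.pos i = c.pos f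
  · rcases h.place_next_of_eq hid hk hn hi with h1 | h1
    · exact Or.inl h1
    · exact Or.inr (Or.inl (Or.inl h1))
  rcases h.next_cases hid hk hn i with hstay | h1
  swap
  · exact Or.inr (Or.inr h1)
  -- a robot that stays at a place not visited by `f` before or now
  have hold : (c.pos i = start f ∨ ∀ k' < k, posAlong P (start f) (M f).tour k' ≠ c.pos i) →
      ((gatheringNext P c).pos i = start f ∨
        ∀ k' < k + 1, posAlong P (start f) (M f).tour k' ≠ (gatheringNext P c).pos i) := by
    rw [hstay]
    rintro (h1 | h1)
    · exact Or.inl h1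
    · refine Or.inr fun k' hk' => ?_
      rcases (Nat.lt_succ_iff.1 hk').lt_or_eq with hk' | rfl
      · exact h1 k' hk'
      · rw [← (h.finder f h.leader).2.2]
        exact Ne.symm hi
  have hrest (hr : (c.state i).role = .finder ∨
      (c.state i).role = .helper ∧ (c.state i).follows = true) :
      (gatheringNext P c).pos i = (gatheringNext P c).pos f ∨
        ((gatheringNext P c).pos i = start f ∨
          ∀ k' < k + 1, posAlong P (start f) (M f).tour k' ≠ (gatheringNext P c).pos i) ∨
        WithFinder ident (gatheringNext P c) i := by
    obtain ⟨g, hg⟩ := exists_leastGroup (c := c) (i := i) (hr.imp_right And.left)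
    rcases h.node_cases hi hg with h1 | ⟨j, hj, hij, rfl⟩
    · exact Or.inr (Or.inl (hold h1))
    · exact Or.inr (Or.inr (h.next_of_leader_present hid hk hn hj hij hg hr))
  rcases h.place i with h1 | h1 | h1 | ⟨h1, h2, -⟩
  · exact absurd h1 hi
  · exact Or.inr (Or.inl (hold h1))
  · exact hrest (Or.inl h1)
  · exact hrest (Or.inr ⟨h1, h2⟩)

theorem next (h : PhaseTwoInv P ident start M f k c) (hid : Function.Injective ident)
    (hk : k < 2 * Fintype.card V) (hn : 0 < Fintype.card V) :
    PhaseTwoInv P ident start M f (k + 1) (gatheringNext P c) := by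
  have hfg := (h.finder f h.leader).1
  refine ⟨fun i => ?_, fun i => ?_, fun i => ?_, fun i => ?_, fun i => ?_, fun i => ?_,
    fun i hi => ?_, fun i hi => ?_, (h.leader_next hk hn).1, ?_, fun i hi => ?_, fun i hi hg => ?_,
    h.place_next hid hk hn, fun i hi hif => ?_⟩
  · obtain ⟨s, o, ho, hs, hp⟩ := h.exists_outcome hk hn i
    rw [hs]
    cases ho <;> exact h.n_eq i
  · obtain ⟨s, o, ho, hs, hp⟩ := h.exists_outcome hk hn i
    rw [hs]
    cases ho <;> exact h.ident_eq i
  · obtain ⟨s, o, ho, hs, hp⟩ := h.exists_outcome hk hn i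
    rw [hs]
    rfl
  · obtain ⟨s, o, ho, hs, hp⟩ := h.exists_outcome hk hn i
    rw [hs]
    cases ho <;> exact h.fits i
  · obtain ⟨s, o, ho, hs, hp⟩ := h.exists_outcome hk hn i
    rw [hs]
    cases ho with
    | lead => exact h.gid_mem i
    | follow g h1 =>
      obtain ⟨⟨j, -, -, rfl⟩, -⟩ := leastFinder_eq_some_iff.1 h1
      exact h.gid_mem j
    | settle g _ h1 =>
      obtain ⟨⟨j, -, -, rfl⟩, -⟩ := leastGroup_eq_some_iff.1 h1
      exact h.gid_mem j
    | keep => exact h.gid_mem i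
    | wait => exact h.gid_mem i
  · obtain ⟨s, o, ho, hs, hp⟩ := h.exists_outcome hk hn i
    rw [hs]
    cases ho with
    | lead => exact h.decided i
    | follow => exact fun h1 => by cases h1
    | settle => exact fun h1 => by cases h1
    | keep => exact h.decided i
    | wait => exact h.decided i
  · obtain ⟨s, o, ho, hs, hp⟩ := h.exists_outcome hk hn i
    rw [hs] at hi
    cases ho with
    | lead h1 => exact h.isFinder i h1
    | follow => cases hi
    | settle => cases hi
    | keep h1 => exact absurd (hi.symm.trans h1) (by decide)
    | wait h1 => exact absurd (hi.symm.trans h1) (by decide)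
  · obtain ⟨s, o, ho, hs, hp⟩ := h.exists_outcome hk hn i
    rw [hs] at hi
    rw [hs, hp]
    cases ho with
    | lead h1 => exact ⟨(h.finder i h1).1, (h.finder i h1).2.1, h.tourPort_eq h1⟩
    | follow => cases hi
    | settle => cases hi
    | keep h1 => exact absurd (hi.symm.trans h1) (by decide)
    | wait h1 => exact absurd (hi.symm.trans h1) (by decide)
  · -- no finder has an identifier below that of `f`, so the anchor stays as it is
    obtain ⟨a, ha, hag, haf, hap⟩ := h.anchor
    refine ⟨a, ?_⟩
    obtain ⟨s, o, ho, hs, hp⟩ := h.exists_outcome hk hn a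
    rw [hs, hp]
    cases ho with
    | lead h1 => rw [ha] at h1; cases h1
    | follow g h1 _ h3 =>
      obtain ⟨⟨j, -, hr, rfl⟩, -⟩ := leastFinder_eq_some_iff.1 h1
      exact absurd (h.least j (Or.inl hr)) (not_le.2 (hag ▸ h3 ha))
    | settle g h1 => rw [ha] at h1; cases h1
    | keep => exact ⟨ha, hag, haf, by simpa [haf] using hap⟩
    | wait h1 => rw [ha] at h1; cases h1
  · obtain ⟨s, o, ho, hs, hp⟩ := h.exists_outcome hk hn i
    rw [hs] at hi ⊢
    cases ho with
    | lead => exact h.least i hi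
    | follow g h1 =>
      obtain ⟨⟨j, -, hr, rfl⟩, -⟩ := leastFinder_eq_some_iff.1 h1
      exact h.least j (Or.inl hr)
    | settle g _ h1 =>
      obtain ⟨⟨j, -, hr, rfl⟩, -⟩ := leastGroup_eq_some_iff.1 h1
      exact h.least j hr
    | keep => exact h.least i hi
    | wait => exact h.least i hi
  · obtain ⟨s, o, ho, hs, hp⟩ := h.exists_outcome hk hn i
    rw [hs] at hi hg ⊢
    rw [hp, (h.leader_next hk hn).2]
    cases ho with
    | lead h1 => exact absurd (hi.symm.trans h1) (by decide)
    | follow g h1 =>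
      change g = ident f at hg
      subst hg
      have hpos := h.pos_eq_leader hid h1
      exact ⟨fun _ => h.move_leaderPort hid h.leader hpos (h.least_at_leader hpos).1,
        fun h2 => Bool.noConfusion h2⟩
    | settle g _ h2 _ h4 =>
      change g = ident f at hg
      subst hg
      refine ⟨fun h5 => Bool.noConfusion h5, fun _ => ?_⟩
      -- the group identifier of `f` comes from a helper that does not follow `f`
      have hne : c.pos i ≠ c.pos f := fun h5 => h4 (h.least_at_leader h5).2
      obtain ⟨⟨x, hx, hr, hgx⟩, -⟩ := leastGroup_eq_some_iff.1 h2
      rcases hr with hr | hr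
      · have : x = f := hid ((h.finder x hr).1.symm.trans hgx)
        exact absurd (this ▸ hx.symm) hne
      · rcases hfo : (c.state x).follows
        · rw [P.move_none, ← hx]
          exact (h.group x hr hgx).2 hfo
        · exact absurd (hx.symm.trans ((h.group x hr hgx).1 hfo)) hne
    | keep h1 =>
      have hg' : (c.state i).gid = ident f := hg
      refine ⟨fun hfo => ?_, fun hfo => ?_⟩
      · have hfo : (c.state i).follows = true := hfo
        have hpos := (h.group i h1 hg').1 hfo
        rw [hfo, hg']
        exact h.move_leaderPort hid h.leader hpos (h.least_at_leader hpos).1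
      · have hfo : (c.state i).follows = false := hfo
        rw [hfo]
        exact (h.group i h1 hg').2 hfo
    | wait h1 => exact absurd (hi.symm.trans h1) (by decide)
  · obtain ⟨s, o, ho, hs, hp⟩ := h.exists_outcome hk hn i
    rw [hs] at hi
    have hlead : (c.state i).role = .finder ∧
        leastGroup (peersOf c i) = some (c.state i).gid := by
      cases ho with
      | lead h1 h2 => exact ⟨h1, h2⟩
      | follow => cases hi
      | settle => cases hi
      | keep h1 => exact absurd (hi.symm.trans h1) (by decide)
      | wait h1 => exact absurd (hi.symm.trans h1) (by decide)
    intro k' hk'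
    rcases (Nat.lt_succ_iff.1 hk').lt_or_eq with hk' | rfl
    · exact h.absorbed i hlead.1 hif k' hk'
    · -- at the root of `f`, the anchor has a smaller group identifier
      intro hroot
      obtain ⟨hgi, -, hpi⟩ := h.finder i hlead.1
      obtain ⟨a, ha, hag, -, hap⟩ := h.anchor
      have := (leastGroup_eq_some_iff.1 hlead.2).2 a (hap.trans (hroot.symm.trans hpi.symm))
        (Or.inr ha)
      rw [hag, hgi] at this
      have h2 := h.least i (Or.inl hlead.1)
      rw [hgi] at h2
      exact hif (hid (le_antisymm this h2))

omit [DecidableEq V] [Fintype ι] in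
/-- At the end of the second phase all robots are at the root of `f`. -/
theorem pos_eq (h : PhaseTwoInv P ident start M f (2 * Fintype.card V) c)
    (hG : G.Connected) (hM : ∀ i, IsFinder ident start i →
      ∃ φ, PartialMap P (start i) (M i) φ ∧ (M i).openPorts = []) (i : ι) :
    c.pos i = start f := by
  have hf : c.pos f = start f := by
    obtain ⟨φ, h1, -⟩ := hM f (h.isFinder f h.leader)
    rw [(h.finder f h.leader).2.2, h1.posAlong_end]
  have huniq : ∀ j, (c.state j).role = .finder → j = f := by
    intro j hj
    by_contra hjf
    obtain ⟨φ, h1, h2⟩ := hM j (h.isFinder j hj)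
    obtain ⟨k, hk, hkx⟩ := h1.exists_posAlong_eq h2 hG (start f)
    exact h.absorbed j hj hjf k hk hkx
  rcases h.place i with h1 | (h1 | h1) | h1 | ⟨-, -, j, hj, -, hij⟩
  · exact h1.trans hf
  · exact h1
  · obtain ⟨φ, h2, h3⟩ := hM f (h.isFinder f h.leader)
    obtain ⟨k, hk, hkx⟩ := h2.exists_posAlong_eq h3 hG (c.pos i)
    exact absurd hkx (h1 k hk)
  · rw [huniq i h1, hf]
  · rw [hij, huniq j hj, hf]

end PhaseTwoInv

end PhaseTwo

/-! ### Encoding memory states as bit strings -/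

/-- No code word of `e` is a proper prefix of another one, and `e` is injective. -/
def PrefixFree {α : Type*} (e : α → List Bool) : Prop :=
  ∀ a b r s, e a ++ r = e b ++ s → a = b ∧ r = s

theorem PrefixFree.injective {α : Type*} {e : α → List Bool} (h : PrefixFree e) :
    Function.Injective e := fun a b hab => (h a b [] [] (by simpa using hab)).1

theorem PrefixFree.comp {α β : Type*} {e : α → List Bool} (h : PrefixFree e) {g : β → α}
    (hg : Function.Injective g) : PrefixFree (e ∘ g) := fun _ _ r s hab =>
  ⟨hg (h _ _ r s hab).1, (h _ _ r s hab).2⟩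

/-- The code of a pair. -/
def encodePair {α β : Type*} (e : α → List Bool) (e' : β → List Bool) (a : α × β) : List Bool :=
  e a.1 ++ e' a.2

theorem PrefixFree.pair {α β : Type*} {e : α → List Bool} {e' : β → List Bool}
    (h : PrefixFree e) (h' : PrefixFree e') : PrefixFree (encodePair e e') := by
  rintro ⟨a, a'⟩ ⟨b, b'⟩ r s hab
  simp only [encodePair, List.append_assoc] at hab
  obtain ⟨rfl, h1⟩ := h _ _ _ _ hab
  obtain ⟨rfl, h2⟩ := h' _ _ _ _ h1
  exact ⟨rfl, h2⟩

/-- The code of a list: each entry is announced by `true`, and `false` marks the end. -/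
def encodeList {α : Type*} (e : α → List Bool) : List α → List Bool
  | [] => [false]
  | a :: l => true :: (e a ++ encodeList e l)

theorem PrefixFree.list {α : Type*} {e : α → List Bool} (h : PrefixFree e) :
    PrefixFree (encodeList e) := by
  intro l
  induction l with
  | nil =>
    rintro (_ | ⟨b, l'⟩) r s hab
    · simpa [encodeList] using hab
    · simp [encodeList] at hab
  | cons a l ih =>
    rintro (_ | ⟨b, l'⟩) r s hab
    · simp [encodeList] at hab
    · simp only [encodeList, List.cons_append, List.append_assoc, List.cons.injEq,
        true_and] at hab
      obtain ⟨rfl, h1⟩ := h _ _ _ _ hab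
      obtain ⟨rfl, h2⟩ := ih _ _ _ h1
      exact ⟨rfl, h2⟩

theorem length_encodeList {α : Type*} (e : α → List Bool) (l : List α) :
    (encodeList e l).length = (l.map fun a => (e a).length + 1).sum + 1 := by
  induction l with
  | nil => rfl
  | cons a l ih =>
    simp only [encodeList, List.length_cons, List.length_append, ih, List.map_cons, List.sum_cons]
    ring

theorem length_encodeList_le {α : Type*} {e : α → List Bool} {l : List α} {β : ℕ}
    (h : ∀ a ∈ l, (e a).length ≤ β) : (encodeList e l).length ≤ l.length * (β + 1) + 1 := by
  rw [length_encodeList]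
  have := List.sum_le_card_nsmul (l.map fun a => (e a).length + 1) (β + 1) (by
    intro x hx
    obtain ⟨a, ha, rfl⟩ := List.mem_map.1 hx
    exact Nat.succ_le_succ (h a ha))
  rw [List.length_map, smul_eq_mul] at this
  omega

/-- The code of a number: the list of its binary digits. -/
def encodeNat (x : ℕ) : List Bool := encodeList (fun b => [b]) x.bits

theorem prefixFree_encodeNat : PrefixFree encodeNat := by
  refine PrefixFree.comp (PrefixFree.list fun a b r s h => ?_) fun a b hab => ?_
  · simpa using h
  · apply Nat.digits_inj_iff (b := 2) |>.1
    rw [Nat.digits_two_eq_bits, Nat.digits_two_eq_bits, hab]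

theorem length_encodeNat_le (x : ℕ) : (encodeNat x).length ≤ 2 * Nat.log 2 x + 3 := by
  have h1 : (encodeNat x).length ≤ x.bits.length * 2 + 1 :=
    length_encodeList_le (β := 1) (by simp)
  have h2 : x.bits.length = (Nat.digits 2 x).length := by
    rw [Nat.digits_two_eq_bits, List.length_map]
  rcases Nat.eq_zero_or_pos x with rfl | hx
  · simp at h1
    omega
  · rw [Nat.length_digits 2 x one_lt_two hx.ne'] at h2
    omega

/-- The code of an optional number. -/
def encodeOption {α : Type*} (e : α → List Bool) (o : Option α) : List Bool :=
  encodeList e o.toList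

theorem PrefixFree.option {α : Type*} {e : α → List Bool} (h : PrefixFree e) :
    PrefixFree (encodeOption e) :=
  h.list.comp fun a b hab => by
    rcases a with _ | a <;> rcases b with _ | b <;> simp_all

theorem length_encodeOption_le {α : Type*} {e : α → List Bool} {o : Option α} {β : ℕ}
    (h : ∀ a, o = some a → (e a).length ≤ β) : (encodeOption e o).length ≤ β + 2 := by
  rcases o with _ | a
  · simp [encodeOption, encodeList]
  · have := h a rfl
    simp [encodeOption, encodeList]
    omega

/-- The code of the record of a node. -/
def encodeRecord (x : NodeRecord) : List Bool :=
  encodePair encodeNat (encodePair encodeNat (encodePair encodeNat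
    (encodeList (encodeOption (encodePair encodeNat encodeNat)))))
    (x.parent, x.down, x.up, x.adj)

theorem prefixFree_encodeRecord : PrefixFree encodeRecord :=
  have h := prefixFree_encodeNat
  PrefixFree.comp (h.pair (h.pair (h.pair (h.pair h).option.list)))
    (g := fun x : NodeRecord => (x.parent, x.down, x.up, x.adj)) (by
      rintro ⟨⟩ ⟨⟩ hxy
      simpa using hxy)

/-- The code of the memory of an explorer. -/
def encodeSurvey (s : Survey) : List Bool :=
  encodePair (encodeList encodeRecord) (encodePair encodeNat (encodePair encodeNat
    (encodePair encodeNat (encodeOption encodeNat)))) (s.map, s.pc, s.q, s.d, s.hit)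

theorem prefixFree_encodeSurvey : PrefixFree encodeSurvey :=
  have h := prefixFree_encodeNat
  PrefixFree.comp (prefixFree_encodeRecord.list.pair (h.pair (h.pair (h.pair h.option))))
    (g := fun s : Survey => (s.map, s.pc, s.q, s.d, s.hit)) (by
      rintro ⟨⟩ ⟨⟩ hxy
      simpa using hxy)

/-- A number for each role. -/
def Role.toNat : Role → ℕ
  | .undecided => 0
  | .finder => 1
  | .helper => 2
  | .waiter => 3

/-- The code of the memory of a robot. -/
def encodeState (s : RobotState) : List Bool :=
  encodePair encodeNat (encodePair encodeNat (encodePair encodeNat (encodePair encodeNat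
    (encodePair encodeNat (encodePair encodeNat encodeSurvey)))))
    (s.n, s.ident, s.clock, s.role.toNat, s.gid, s.follows.toNat, s.survey)

theorem prefixFree_encodeState : PrefixFree encodeState :=
  have h := prefixFree_encodeNat
  PrefixFree.comp (h.pair (h.pair (h.pair (h.pair (h.pair (h.pair prefixFree_encodeSurvey))))))
    (g := fun s : RobotState =>
      (s.n, s.ident, s.clock, s.role.toNat, s.gid, s.follows.toNat, s.survey)) (by
      rintro ⟨_, _, _, r, _, f, _⟩ ⟨_, _, _, r', _, f', _⟩ hxy
      have hr : r.toNat = r'.toNat → r = r' := by cases r <;> cases r' <;> decide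
      have hf : f.toNat = f'.toNat → f = f' := by cases f <;> cases f' <;> decide
      simp only [Prod.mk.injEq] at hxy
      obtain ⟨rfl, rfl, rfl, h4, rfl, h6, rfl⟩ := hxy
      rw [hr h4, hf h6])

/-! ### The length of the codes -/

theorem sum_map_eq_sum_node (M : GraphMap) (g : NodeRecord → ℕ) :
    (M.map g).sum = ∑ v ∈ Finset.range M.length, g (M.node v) := by
  have : M.map g = (List.range M.length).map fun v => g (M.node v) := by
    apply List.ext_getElem
    · simp
    · intro i h1 h2
      have hi : i < M.length := by simpa using h1
      simp [GraphMap.node, hi]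
  rw [this]
  rfl

section Length

variable {V : Type*} [Fintype V] {G : SimpleGraph V} [DecidableRel G.Adj] {P : PortLabeling G}
  {β : ℕ}

theorem PartialMap.length_encodeList_le {r : V} {M : GraphMap} {φ : ℕ → V}
    (h : PartialMap P r M φ) (hβ : ∀ x ≤ Fintype.card V, (encodeNat x).length ≤ β) :
    (encodeList encodeRecord M).length ≤
      Fintype.card V * (3 * β + 2) + 2 * G.edgeFinset.card * (2 * β + 3) + 1 := by
  rw [length_encodeList, sum_map_eq_sum_node]
  have hdeg : ∀ {v p : ℕ} {w q}, P.traverse (φ v) p = some (w, q) → p ≤ Fintype.card V :=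
    fun ht => (P.lt_degree_of_traverse ht).le.trans (G.degree_lt_card_verts _).le
  have hle := h.length_le
  have hrec : ∀ v ∈ Finset.range M.length, (encodeRecord (M.node v)).length + 1 ≤
      (3 * β + 2) + (M.node v).adj.length * (2 * β + 3) := by
    intro v hv
    have hv := Finset.mem_range.1 hv
    have h3 : (M.node v).parent ≤ Fintype.card V ∧ (M.node v).down ≤ Fintype.card V ∧
        (M.node v).up ≤ Fintype.card V := by
      by_cases h0 : v = 0
      · subst h0
        obtain ⟨h1, h2, h3⟩ := h.root_record
        omega
      · obtain ⟨h1, h2⟩ := h.tree v hv h0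
        exact ⟨by omega, hdeg h2, hdeg (P.traverse_symm h2)⟩
    have h4 := RobotGathering.length_encodeList_le (l := (M.node v).adj)
      (e := encodeOption (encodePair encodeNat encodeNat)) (β := 2 * β + 2) (by
      intro o ho
      refine length_encodeOption_le (β := 2 * β) ?_
      rintro ⟨w, q⟩ rfl
      obtain ⟨p, hp, hpo⟩ := List.getElem_of_mem ho
      obtain ⟨h5, h6⟩ := h.adj v hv p w q (List.getElem?_eq_some_iff.2 ⟨hp, hpo⟩)
      have h7 := hβ w (by omega)
      have h8 := hβ q (hdeg (P.traverse_symm h6))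
      simp only [encodePair, List.length_append]
      omega)
    have h5 := hβ _ h3.1
    have h6 := hβ _ h3.2.1
    have h7 := hβ _ h3.2.2
    rw [show 2 * β + 2 + 1 = 2 * β + 3 from rfl] at h4
    simp only [encodeRecord, encodePair, List.length_append] at h4 ⊢
    omega
  have h1 := Finset.sum_le_sum hrec
  have e : ∑ v ∈ Finset.range M.length, ((3 * β + 2) + (M.node v).adj.length * (2 * β + 3)) =
      M.length * (3 * β + 2) +
        (∑ v ∈ Finset.range M.length, (M.node v).adj.length) * (2 * β + 3) := by
    rw [Finset.sum_add_distrib, ← Finset.sum_mul]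
    simp
  rw [e] at h1
  have h2 := Nat.mul_le_mul_right (2 * β + 3) h.sum_degree_le
  have h3 := Nat.mul_le_mul_right (3 * β + 2) hle
  omega

theorem SurveyFits.length_encodeSurvey_le {s : Survey} (h : SurveyFits P s)
    (hβ : ∀ x ≤ 6 * Fintype.card V, (encodeNat x).length ≤ β) :
    (encodeSurvey s).length ≤
      Fintype.card V * (3 * β + 2) + 2 * G.edgeFinset.card * (2 * β + 3) + 4 * β + 3 := by
  rcases h with rfl | ⟨r, φ, h1, h2, h3, h4, h5⟩
  · have h0 := hβ 0 (by omega)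
    simp only [encodeSurvey, encodePair, Survey.fresh, encodeOption, Option.toList_none,
      encodeList, List.length_append, List.length_singleton]
    omega
  · have h6 := h1.length_encodeList_le fun x hx => hβ x (by omega)
    have h7 := hβ _ h2
    have h8 := hβ s.q (by omega)
    have h9 := hβ s.d (by omega)
    have h10 := length_encodeOption_le (e := encodeNat) (o := s.hit) (β := β)
      fun a ha => hβ a (by have := h5 a ha; omega)
    simp only [encodeSurvey, encodePair, List.length_append]
    omega

/-- The bound on the memory of a robot, in terms of a bound on the codes of the numbers that occur
in it. -/
theorem length_encodeState_le {s : RobotState} (h : SurveyFits P s.survey)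
    (hβ : ∀ x ≤ 6 * Fintype.card V, (encodeNat x).length ≤ β) (hn : s.n ≤ Fintype.card V)
    (hV : 2 ≤ Fintype.card V) (hm : Fintype.card V ≤ 2 * G.edgeFinset.card)
    (h1 : (encodeNat s.ident).length ≤ β) (h2 : (encodeNat s.clock).length ≤ β)
    (h3 : (encodeNat s.gid).length ≤ β) :
    (encodeState s).length ≤ 40 * β * G.edgeFinset.card := by
  have h4 := h.length_encodeSurvey_le hβ
  have h5 := hβ s.n (by omega)
  have h6 := hβ s.role.toNat (by cases s.role <;> simp only [Role.toNat] <;> omega)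
  have h7 := hβ s.follows.toNat (by cases s.follows <;> simp only [Bool.toNat, cond] <;> omega)
  have hβ1 : 1 ≤ β := by
    refine le_trans ?_ (hβ 0 (by omega))
    simp [encodeNat, encodeList]
  have h8 : (encodeState s).length ≤
      Fintype.card V * (3 * β + 2) + 2 * G.edgeFinset.card * (2 * β + 3) + 10 * β + 3 := by
    simp only [encodeState, encodePair, List.length_append]
    omega
  have h9 : Fintype.card V * (3 * β + 2) ≤ 2 * G.edgeFinset.card * (5 * β) :=
    Nat.mul_le_mul hm (by omega)
  have h10 : 2 * G.edgeFinset.card * (2 * β + 3) ≤ 2 * G.edgeFinset.card * (5 * β) :=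
    Nat.mul_le_mul le_rfl (by omega)
  have h11 : β ≤ β * G.edgeFinset.card := Nat.le_mul_of_pos_right _ (by omega)
  have e : 40 * β * G.edgeFinset.card = 2 * (2 * G.edgeFinset.card * (5 * β)) +
    20 * (β * G.edgeFinset.card) := by ring
  omega

end Length

/-- The codes of numbers bounded by a polynomial in `n` have length `O(log n)`. -/
theorem length_encodeNat_le_logb {n x : ℕ} {b : ℝ} (hn : 2 ≤ n) (hb : 0 ≤ b)
    (hx : (x : ℝ) ≤ (n : ℝ) ^ b) :
    ((encodeNat x).length : ℝ) ≤ (2 * b + 3) * Real.logb 2 n := by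
  have hn1 : (1 : ℝ) < n := by exact_mod_cast hn
  have hL : 1 ≤ Real.logb 2 n := by
    rw [Real.le_logb_iff_rpow_le (by norm_num) (by linarith)]
    simpa using (by exact_mod_cast hn : (2 : ℝ) ≤ n)
  have h1 : ((encodeNat x).length : ℝ) ≤ 2 * (Nat.log 2 x : ℝ) + 3 := by
    exact_mod_cast length_encodeNat_le x
  have h2 : (Nat.log 2 x : ℝ) ≤ b * Real.logb 2 n := by
    rcases Nat.eq_zero_or_pos x with rfl | hx0
    · simp only [Nat.log_zero_right, Nat.cast_zero]
      positivity
    · have h3 : (Nat.log 2 x : ℝ) ≤ Real.logb 2 x := by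
        have := Real.natLog_le_logb x 2
        exact_mod_cast this
      refine h3.trans ?_
      rw [← Real.logb_rpow_eq_mul_logb_of_pos (by linarith)]
      exact Real.logb_le_logb_of_le (by norm_num) (by exact_mod_cast hx0) hx
  linarith

/-! ### The whole execution -/

section Execution

variable {V ι : Type*} [Fintype V] [DecidableEq V] [Fintype ι]
  {G : SimpleGraph V} [DecidableRel G.Adj]

omit [Fintype V] [DecidableEq V] in
theorem exists_least_isFinder (ident : ι → ℕ) {start : ι → V} (h : Undispersed start) :
    ∃ f, IsFinder ident start f ∧ ∀ i, IsFinder ident start i → ident f ≤ ident i := by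
  classical
  obtain ⟨j, hj⟩ := h
  obtain ⟨i, hi, -⟩ := exists_isFinder ident hj
  obtain ⟨f, hf, hmin⟩ := Finset.exists_min_image
    (Finset.univ.filter fun i => IsFinder ident start i) ident ⟨i, by simp [hi]⟩
  exact ⟨f, by simpa using hf, fun k hk => hmin k (by simp [hk])⟩

/-- The map of robot `i` at the end of the first phase. -/
def finalMap (P : PortLabeling G) (ident : ι → ℕ) (start : ι → V) (i : ι) : GraphMap :=
  ((gatheringRun P ident start (phaseOneLength (Fintype.card V))).state i).survey.map

theorem phaseOne_end [Nonempty V] (P : PortLabeling G) {ident : ι → ℕ}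
    (hid : Function.Injective ident) {start : ι → V} {i : ι} (hi : IsFinder ident start i) :
    (∃ φ, PartialMap P (start i) (finalMap P ident start i) φ ∧
      (finalMap P ident start i).openPorts = []) ∧
    (gatheringRun P ident start (phaseOneLength (Fintype.card V))).pos i = start i ∧
    ∀ j, j ≠ i → start j = start i →
      (gatheringRun P ident start (phaseOneLength (Fintype.card V))).pos j = start i := by
  have hpos : 2 ≤ phaseOneLength (Fintype.card V) := by
    have : 0 < Fintype.card V ^ 3 := pow_pos Fintype.card_pos 3
    unfold phaseOneLength
    omega
  obtain ⟨t, ht⟩ : ∃ t, t + 2 = phaseOneLength (Fintype.card V) := ⟨_, Nat.sub_add_cancel hpos⟩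
  obtain ⟨M, φ, h1, h2, h3, h4, h5⟩ :=
    (phaseOneInv_run P hid start (t := t) (by omega)).next_complete hid ht hi
  rw [← gatheringRun_succ, ht] at h1 h4 h5
  have hM : finalMap P ident start i = M := by
    unfold finalMap
    rw [h1]
    rfl
  rw [hM]
  exact ⟨⟨φ, h2, h3⟩, h4, h5⟩

theorem PhaseOneInv.gid_mem {P : PortLabeling G} {ident : ι → ℕ} {start : ι → V} {t : ℕ}
    {c : Config V ι RobotState} (h : PhaseOneInv P ident start t c) (i : ι) :
    (c.state i).gid = 0 ∨ ∃ j, (c.state i).gid = ident j := by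
  rcases role_cases ident start i with hi | ⟨k, hk, hik, hs⟩ | hi
  · exact Or.inr ⟨i, (h.finder i hi).2⟩
  · exact Or.inr ⟨k, (h.helper k i hk hik hs).2⟩
  · exact Or.inl (h.waiter i hi).2.1

theorem phaseTwoInv_run [Nonempty V] (P : PortLabeling G) {ident : ι → ℕ}
    (hid : Function.Injective ident) {start : ι → V} {f : ι} (hf : IsFinder ident start f)
    (hmin : ∀ i, IsFinder ident start i → ident f ≤ ident i) {k : ℕ}
    (hk : k ≤ 2 * Fintype.card V) :
    PhaseTwoInv P ident start (finalMap P ident start) f k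
      (gatheringRun P ident start (phaseOneLength (Fintype.card V) + k)) := by
  have hn : 0 < Fintype.card V := Fintype.card_pos
  induction k with
  | succ k ih => exact (ih (by omega)).next hid (by omega) hn
  | zero =>
    have hpos : 1 ≤ phaseOneLength (Fintype.card V) := by
      have : 0 < Fintype.card V ^ 3 := pow_pos hn 3
      unfold phaseOneLength
      omega
    obtain ⟨t, ht⟩ : ∃ t, t + 1 = phaseOneLength (Fintype.card V) := ⟨_, Nat.sub_add_cancel hpos⟩
    have h := phaseOneInv_run P hid start ht.le
    rw [ht] at h
    have hend := fun i (hi : IsFinder ident start i) => phaseOne_end P hid hi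
    rw [add_zero]
    refine ⟨h.n_eq, h.ident_eq, fun i => (h.clock_eq i).trans ht, h.fits, h.gid_mem, fun i => ?_,
      fun i => h.isFinder_of_role, fun i hi => ?_, (h.finder f hf).1, ?_, fun i hi => ?_,
      fun i hi hg => ⟨fun hfo => ?_, fun _ => ?_⟩, fun i => ?_,
      fun i _ _ k' hk' => absurd hk' (Nat.not_lt_zero k')⟩
    · rcases role_cases ident start i with hi | ⟨k, hk, hik, hs⟩ | hi
      · rw [(h.finder i hi).1]; decide
      · rw [(h.helper k i hk hik hs).1]; decide
      · rw [(h.waiter i hi).1]; decide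
    · have hi := h.isFinder_of_role hi
      exact ⟨(h.finder i hi).2, rfl, (hend i hi).2.1⟩
    · obtain ⟨a, haf, hs⟩ := hf.1
      obtain ⟨h1, h2⟩ := h.helper f a hf haf hs
      exact ⟨a, h1, h2, h.follows_eq a, (hend f hf).2.2 a haf hs⟩
    · rcases role_cases ident start i with hi | ⟨k, hk, hik, hs⟩ | hw
      · rw [(h.finder i hi).2]; exact hmin i hi
      · rw [(h.helper k i hk hik hs).2]; exact hmin k hk
      · rw [(h.waiter i hw).1] at hi
        rcases hi with hi | hi <;> cases hi
    · rw [h.follows_eq] at hfo; cases hfo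
    · obtain ⟨h1, h2⟩ := h.helper_of_role hid hi hg
      exact (hend f hf).2.2 i h1 h2
    · exact Or.inr (Or.inl (Or.inr fun k' hk' => absurd hk' (Nat.not_lt_zero k')))

/-- After the end of the second phase nothing changes. -/
theorem gatheringRun_end [Nonempty V] (P : PortLabeling G) {ident : ι → ℕ}
    (hid : Function.Injective ident) {start : ι → V} {f : ι} (hf : IsFinder ident start f)
    (hmin : ∀ i, IsFinder ident start i → ident f ≤ ident i) (j : ℕ) (i : ι) :
    (gatheringRun P ident start
      (phaseOneLength (Fintype.card V) + 2 * Fintype.card V + j)).state i =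
      (gatheringRun P ident start
        (phaseOneLength (Fintype.card V) + 2 * Fintype.card V)).state i ∧
    (gatheringRun P ident start
      (phaseOneLength (Fintype.card V) + 2 * Fintype.card V + j)).pos i =
      (gatheringRun P ident start
        (phaseOneLength (Fintype.card V) + 2 * Fintype.card V)).pos i := by
  have h := phaseTwoInv_run P hid hf hmin le_rfl
  induction j with
  | zero => exact ⟨rfl, rfl⟩
  | succ j ih =>
    rw [← Nat.add_assoc, gatheringRun_succ, ← ih.1, ← ih.2]
    have hdone : ¬ Running ((gatheringRun P ident start
        (phaseOneLength (Fintype.card V) + 2 * Fintype.card V + j)).state i) := by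
      rw [ih.1, Running, h.clock_eq, h.n_eq]
      exact not_not.2 rfl
    have hd := decision_of_not_running (G := G) hdone
    refine ⟨congrArg Prod.fst hd, ?_⟩
    change P.move _ (undispersedGathering.decision G _ i).2 = _
    rw [hd, P.move_none]

/-- The facts about the memory of a robot that hold at all times. -/
theorem state_gatheringRun [Nonempty V] (P : PortLabeling G) {ident : ι → ℕ}
    (hid : Function.Injective ident) {start : ι → V} (hu : Undispersed start) (t : ℕ) (i : ι) :
    ((gatheringRun P ident start t).state i).n = Fintype.card V ∧
    ((gatheringRun P ident start t).state i).ident = ident i ∧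
    ((gatheringRun P ident start t).state i).clock =
      min t (phaseOneLength (Fintype.card V) + 2 * Fintype.card V) ∧
    SurveyFits P ((gatheringRun P ident start t).state i).survey ∧
    (((gatheringRun P ident start t).state i).gid = 0 ∨
      ∃ j, ((gatheringRun P ident start t).state i).gid = ident j) := by
  obtain ⟨f, hf, hmin⟩ := exists_least_isFinder ident hu
  have htwo : ∀ k ≤ 2 * Fintype.card V, _ := fun k hk => phaseTwoInv_run P hid hf hmin hk
  rcases le_total t (phaseOneLength (Fintype.card V)) with ht | ht
  · rcases t with _ | t
    · exact ⟨rfl, rfl, (Nat.zero_min _).symm, Or.inl rfl, Or.inl rfl⟩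
    · have h := phaseOneInv_run P hid start ht
      exact ⟨h.n_eq i, h.ident_eq i, by rw [h.clock_eq]; omega, h.fits i, h.gid_mem i⟩
  · rcases le_total t (phaseOneLength (Fintype.card V) + 2 * Fintype.card V) with ht' | ht'
    · obtain ⟨k, rfl⟩ := Nat.exists_eq_add_of_le ht
      have h := htwo k (by omega)
      exact ⟨h.n_eq i, h.ident_eq i, by rw [h.clock_eq]; omega, h.fits i, h.gid_mem i⟩
    · obtain ⟨j, rfl⟩ := Nat.exists_eq_add_of_le ht'
      have h := htwo _ le_rfl
      rw [(gatheringRun_end P hid hf hmin j i).1]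
      exact ⟨h.n_eq i, h.ident_eq i, by rw [h.clock_eq]; omega, h.fits i, h.gid_mem i⟩

theorem terminated_run_iff [Nonempty V] (P : PortLabeling G) {ident : ι → ℕ}
    (hid : Function.Injective ident) {start : ι → V} (hu : Undispersed start) (t : ℕ) (i : ι) :
    undispersedGathering.terminated ((undispersedGathering.run P ident start t).state i) = true ↔
      phaseOneLength (Fintype.card V) + 2 * Fintype.card V ≤ t := by
  obtain ⟨h1, -, h2, -⟩ := state_gatheringRun P hid hu t i
  have h3 : undispersedGathering.terminated
      ((undispersedGathering.run P ident start t).state i) = true ↔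
      ((gatheringRun P ident start t).state i).clock =
        phaseOneLength ((gatheringRun P ident start t).state i).n +
          2 * ((gatheringRun P ident start t).state i).n := decide_eq_true_iff
  rw [h3, h1, h2, min_eq_right_iff]

omit [DecidableEq V] [Fintype ι] in
/-- Distinct identifiers from `[1, n ^ b]` and two robots at the same node exclude the graph with
one node. -/
theorem two_le_card {ident : ι → ℕ} {start : ι → V} {b : ℝ} (hid : Function.Injective ident)
    (hrange : ∀ i, 1 ≤ ident i ∧ (ident i : ℝ) ≤ (Fintype.card V : ℝ) ^ b)
    (hu : Undispersed start) : 2 ≤ Fintype.card V := by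
  obtain ⟨i, j, hji, -⟩ := hu
  by_contra hn
  have : Nonempty V := ⟨start i⟩
  have hc : Fintype.card V = 1 := by
    have : 0 < Fintype.card V := Fintype.card_pos
    omega
  have h1 : ∀ k, ident k = 1 := by
    intro k
    obtain ⟨h2, h3⟩ := hrange k
    rw [hc, Nat.cast_one, Real.one_rpow] at h3
    have : ident k ≤ 1 := by exact_mod_cast h3
    omega
  exact hji (hid ((h1 j).trans (h1 i).symm))

omit [DecidableEq V] in
theorem card_le_two_mul_card_edgeFinset (hG : G.Connected) (hn : 2 ≤ Fintype.card V) :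
    Fintype.card V ≤ 2 * G.edgeFinset.card := by
  have : Nontrivial V := Fintype.one_lt_card_iff_nontrivial.1 hn
  rw [← G.sum_degrees_eq_twice_card_edges]
  calc Fintype.card V = ∑ _v : V, 1 := by simp
    _ ≤ _ := Finset.sum_le_sum fun v _ => hG.preconnected.degree_pos_of_nontrivial v

end Execution

end RobotGathering

open RobotGathering in
theorem mainTheorem4 :
    ∃ C : ℕ, ∃ enc : RobotState → List Bool, Function.Injective enc ∧
      ∀ b : ℝ, 1 < b → ∃ K : ℝ,
        ∀ (V ι : Type*) [Fintype V] [DecidableEq V] [Fintype ι]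
          (G : SimpleGraph V) [DecidableRel G.Adj] (P : PortLabeling G)
          (ident : ι → ℕ) (start : ι → V),
          G.Connected →
          Function.Injective ident →
          (∀ i, 1 ≤ ident i ∧ (ident i : ℝ) ≤ (Fintype.card V : ℝ) ^ b) →
          Undispersed start →
          -- when the first phase is over, every finder has a map isomorphic to the graph
          (∀ i, IsFinder ident start i →
            ((undispersedGathering.run P ident start
              (phaseOneLength (Fintype.card V))).state i).survey.map.IsMapOf P (start i)) ∧
          -- all robots gather with detection in `O(n ^ 3)` rounds,
          -- at the initial node of the finder of smallest identifier
          (∃ f, IsFinder ident start f ∧ (∀ i, IsFinder ident start i → ident f ≤ ident i) ∧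
            ∃ T ≤ C * Fintype.card V ^ 3,
              undispersedGathering.GathersWithDetection P ident start (start f) T) ∧
          -- the memory of each robot always fits into `O(m log n)` bits
          ∀ t i, ((enc ((undispersedGathering.run P ident start t).state i)).length : ℝ) ≤
            K * G.edgeFinset.card * Real.logb 2 (Fintype.card V) := by
  refine ⟨8, encodeState, prefixFree_encodeState.injective, fun b hb =>
    ⟨40 * (2 * (b + 6) + 3), ?_⟩⟩
  intro V ι _ _ _ G _ P ident start hG hid hrange hu
  have hV : Nonempty V := hG.nonempty
  have hn := two_le_card hid hrange hu
  have hm := card_le_two_mul_card_edgeFinset hG hn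
  obtain ⟨f, hf, hmin⟩ := exists_least_isFinder ident hu
  refine ⟨fun i hi => ?_, ⟨f, hf, hmin,
    phaseOneLength (Fintype.card V) + 2 * Fintype.card V, ?_, fun i => ?_, fun t i ht j => ?_⟩,
    fun t i => ?_⟩
  · obtain ⟨φ, h1, h2⟩ := (phaseOne_end P hid hi).1
    exact h1.isMapOf h2 hG
  · -- `6 n ^ 3 + 2 n ≤ 8 n ^ 3`
    have : Fintype.card V ≤ Fintype.card V ^ 3 := Nat.le_self_pow (by norm_num) _
    unfold phaseOneLength
    omega
  · exact (terminated_run_iff P hid hu _ i).2 le_rfl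
  · have h3 := (terminated_run_iff P hid hu t i).1 ht
    obtain ⟨l, rfl⟩ := Nat.exists_eq_add_of_le h3
    refine ((gatheringRun_end P hid hf hmin l j).2).trans ?_
    exact (phaseTwoInv_run P hid hf hmin le_rfl).pos_eq hG
      (fun i hi => (phaseOne_end P hid hi).1) j
  · obtain ⟨h1, h2, h3, h4, h5⟩ := state_gatheringRun P hid hu t i
    have hn2 : (2 : ℝ) ≤ Fintype.card V := by exact_mod_cast hn
    have hn0 : (0 : ℝ) < Fintype.card V := by linarith
    -- all numbers in the memory are at most `n ^ (b + 6)`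
    have hpow : (Fintype.card V : ℝ) ^ b * 64 ≤ (Fintype.card V : ℝ) ^ (b + 6) := by
      rw [Real.rpow_add hn0]
      refine mul_le_mul_of_nonneg_left ?_ (Real.rpow_nonneg hn0.le b)
      have : (2 : ℝ) ^ 6 ≤ (Fintype.card V : ℝ) ^ 6 := pow_le_pow_left₀ (by norm_num) hn2 6
      have h6 : (Fintype.card V : ℝ) ^ (6 : ℝ) = (Fintype.card V : ℝ) ^ 6 := by
        exact_mod_cast Real.rpow_natCast (Fintype.card V : ℝ) 6
      rw [h6]
      linarith
    have hpow' : (8 : ℝ) * (Fintype.card V : ℝ) ^ 3 ≤ (Fintype.card V : ℝ) ^ (b + 6) := by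
      have h6 : (Fintype.card V : ℝ) ^ (6 : ℝ) = (Fintype.card V : ℝ) ^ 6 := by
        exact_mod_cast Real.rpow_natCast (Fintype.card V : ℝ) 6
      calc (8 : ℝ) * (Fintype.card V : ℝ) ^ 3
          ≤ (Fintype.card V : ℝ) ^ 3 * (Fintype.card V : ℝ) ^ 3 := by
            refine mul_le_mul_of_nonneg_right ?_ (by positivity)
            have : (2 : ℝ) ^ 3 ≤ (Fintype.card V : ℝ) ^ 3 := pow_le_pow_left₀ (by norm_num) hn2 3
            linarith
        _ = (Fintype.card V : ℝ) ^ (6 : ℝ) := by rw [h6]; ring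
        _ ≤ _ := Real.rpow_le_rpow_of_exponent_le (by linarith) (by linarith)
    obtain ⟨β, hβ⟩ : ∃ β : ℝ, β = (2 * (b + 6) + 3) * Real.logb 2 (Fintype.card V) := ⟨_, rfl⟩
    have hcode : ∀ x : ℕ, (x : ℝ) ≤ (Fintype.card V : ℝ) ^ (b + 6) →
        (encodeNat x).length ≤ ⌊β⌋₊ := fun x hx => Nat.le_floor <| by
      rw [hβ]
      exact length_encodeNat_le_logb hn (by linarith) hx
    have hident : ∀ j, (ident j : ℝ) ≤ (Fintype.card V : ℝ) ^ (b + 6) := fun j => by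
      have := (hrange j).2
      have := Real.rpow_nonneg hn0.le b
      linarith
    have hsmall : ∀ x ≤ 6 * Fintype.card V ^ 3 + 2 * Fintype.card V,
        (x : ℝ) ≤ (Fintype.card V : ℝ) ^ (b + 6) := fun x hx => by
      refine le_trans ?_ hpow'
      have : Fintype.card V ≤ Fintype.card V ^ 3 := Nat.le_self_pow (by norm_num) _
      have : x ≤ 8 * Fintype.card V ^ 3 := by omega
      exact_mod_cast this
    have hlen := length_encodeState_le h4 (β := ⌊β⌋₊) (fun x hx => hcode x (hsmall x (by
        have : Fintype.card V ≤ Fintype.card V ^ 3 := Nat.le_self_pow (by norm_num) _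
        omega))) h1.le hn hm
      (hcode _ (by rw [h2]; exact hident i))
      (hcode _ (hsmall _ (by rw [h3]; unfold phaseOneLength; omega)))
      (hcode _ (by
        rcases h5 with h5 | ⟨j, h5⟩ <;> rw [h5]
        · exact hsmall 0 (Nat.zero_le _)
        · exact hident j))
    have hβ0 : 0 ≤ β := by
      rw [hβ]
      exact mul_nonneg (by linarith) (Real.logb_nonneg (by norm_num) (by linarith))
    calc ((encodeState ((undispersedGathering.run P ident start t).state i)).length : ℝ)
        ≤ 40 * (⌊β⌋₊ : ℝ) * G.edgeFinset.card := by exact_mod_cast hlen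
      _ ≤ 40 * β * G.edgeFinset.card := by
          have := Nat.floor_le hβ0
          gcongr
      _ = _ := by rw [hβ]; ring
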